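/- **Setting.** Let $d,T\ge 1$. Write $x=(x_1,\dots,x_T)\in\mathbb{R}^{dT}$ with $x_t\in\mathbb{R}^d$, and put $\|x\|=\sum_{t=1}^T\|x_t\|_{\mathbb{R}^d}$ with the Euclidean norm on $\mathbb{R}^d$. For $\sigma>0$ let $\mathcal N_\sigma=\mathcal N(0,\sigma^2 I_{dT})$. For Borel probability measures $\mu,\nu$ on $\mathbb{R}^{dT}$ let $$\mathcal{AW}_1(\mu,\nu)=\inf_{\pi}\int\|x-y\|\,\pi(dx,dy),\qquad \mathcal{AW}_1^{(\sigma)}(\mu,\nu)=\mathcal{AW}_1(\mu*\mathcal N_\sigma,\nu*\mathcal N_\sigma),$$ where the infimum runs over the bicausal couplings $\pi$ of $\mu$ and $\nu$, i.e. the couplings such that for all $t=1,\dots,T-1$ and $\pi$-almost every $(x,y)$ the conditional law under $\pi$ of $(x_{t+1},y_{t+1})$ given $(x_{1:t},y_{1:t})$ is a coupling of the conditional law of $x_{t+1}$ given $x_{1:t}$ under $\mu$ and the conditional law of $y_{t+1}$ given $y_{1:t}$ under $\nu$. For i.i.d. samples $X^{(1)},X^{(2)},\dots$ of $\mu$ on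 a probability space $(\Omega,\mathcal F,\mathbb P)$ let $\mu^N=\frac1N\sum_{n=1}^N\delta_{X^{(n)}}$. Let $M_p(\mu)=\int\|x\|^p\,\mu(dx)$. **Theorem 4.4.** There are a constant $c_1>0$ depending only on $d,T$, and constants $C_1,C_2>0$ depending only on $d,T,p$, and for every compact set $K\subseteq\mathbb{R}^{dT}$ there is a constant $C_K>0$ depending only on $d,T,K$, such that the following holds. Let $\mu$ be a Borel probability measure with $\mu(K)=1$, let $\sigma\in(0,1]$ and $p>dT+2$, and put $M_p=M_p(\mu)$, $$C_{\sigma,p,M_p}=\left(\int_{\mathbb{R}^{dT}}\frac{(\|x\|+\frac12)^2}{1+\|x\|^p}\,dx\right)^{1/2}\sqrt{\big(C_1(2^pM_p+1)+C_2\,2^p\sigma^p\big)\frac{1}{(2\pi\sigma)^{dT}}},\qquad c_{\sigma,K}=c_1\Big(\sup_{x\in K}\frac{1+2\|x\|}{2\sigma}+1\Big).$$ Then $0<C_{\sigma,p,M_p}<\infty$, $0<c_{\sigma,K}<\infty$, and for all i.i.d. samples of $\mu$, all $N\ge 1$ and all $x>0$, $$\mathbb{E}\big[\mathcal{AW}_1^{(\sigma)}(\mu,\mu^N)\big]\le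 C_K\,C_{\sigma,p,M_p}\,N^{-1/2},$$ $$\mathbb{P}\Big(\mathcal{AW}_1^{(\sigma)}(\mu,\mu^N)\ge x+C_K\,C_{\sigma,p,M_p}\,N^{-1/2}\Big)\le \exp\Big(-\frac{Nx^2}{C_K^2\,c_{\sigma,K}^2}\Big).$$ -/

import Mathlib

open MeasureTheory ProbabilityTheory Filter Topology
open scoped ENNReal NNReal

namespace AdaptedWasserstein

/-- The space `ℝ^{dT}` of paths `x = (x_1, …, x_T)` with `x_t ∈ ℝ^d`, where `ℝ^d` carries the
Euclidean norm. (Times are indexed by `0, …, T - 1`.) Only the topology, the Borel `σ`-algebra, the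
Lebesgue measure and the vector space structure of this product are used; the norm on paths is
`pathNorm` below. -/
abbrev Path (d T : ℕ) : Type := Fin T → EuclideanSpace ℝ (Fin d)

/-- The sum-norm `‖x‖ = ∑_t ‖x_t‖` on the path space. -/
noncomputable def pathNorm {d T : ℕ} (x : Path d T) : ℝ := ∑ t, ‖x t‖

/-- The part `(x_s)_{s < t}` of a path strictly before time `t` (an empty tuple for the first
time). -/
def past {d T : ℕ} (t : Fin T) (x : Path d T) : {s : Fin T // s < t} → EuclideanSpace ℝ (Fin d) :=
  fun s => x s

/-- `π` is a coupling of `μ` and `ν`. If `μ` is a probability measure, then so is `π`. -/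
def IsCoupling {α : Type*} [MeasurableSpace α] (μ ν : Measure α) (π : Measure (α × α)) : Prop :=
  π.map Prod.fst = μ ∧ π.map Prod.snd = ν

/-- The Markov kernel `κ` is a version of the regular conditional distribution of `Y` given `X`
under `m`. -/
def IsCondKernel {α β γ : Type*} [MeasurableSpace α] [MeasurableSpace β] [MeasurableSpace γ]
    (m : Measure α) (X : α → β) (Y : α → γ) (κ : Kernel β γ) : Prop :=
  IsMarkovKernel κ ∧ m.map (fun a => (X a, Y a)) = (m.map X).compProd κ

/-- Bicausal couplings: couplings `π` of `μ` and `ν` such that at every time `t` the conditional law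
under `π` of `(x_t, y_t)`, given the two pasts before `t`, is almost surely a coupling of the
conditional law of `x_t` given its past under `μ` and of `y_t` given its past under `ν`. Conditional
kernels are unique up to null sets, so it does not matter which versions are used. At the first
time the condition says that the law of `(x_1, y_1)` is a coupling of the first marginals. -/
def IsBicausalCoupling {d T : ℕ} (μ ν : Measure (Path d T))
    (π : Measure (Path d T × Path d T)) : Prop :=
  IsCoupling μ ν π ∧
    ∀ t : Fin T,
      ∃ (κμ κν : Kernel ({s : Fin T // s < t} → EuclideanSpace ℝ (Fin d))
          (EuclideanSpace ℝ (Fin d)))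
        (κπ : Kernel (({s : Fin T // s < t} → EuclideanSpace ℝ (Fin d)) ×
            ({s : Fin T // s < t} → EuclideanSpace ℝ (Fin d)))
          (EuclideanSpace ℝ (Fin d) × EuclideanSpace ℝ (Fin d))),
        IsCondKernel μ (past t) (fun x => x t) κμ ∧
        IsCondKernel ν (past t) (fun y => y t) κν ∧
        IsCondKernel π (fun z => (past t z.1, past t z.2)) (fun z => (z.1 t, z.2 t)) κπ ∧
        ∀ᵐ z ∂π, IsCoupling (κμ (past t z.1)) (κν (past t z.2)) (κπ (past t z.1, past t z.2))

/-- The first order adapted Wasserstein distance, as an extended nonnegative real. -/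
noncomputable def adaptedWasserstein {d T : ℕ} (μ ν : Measure (Path d T)) : ℝ≥0∞ :=
  ⨅ (π : Measure (Path d T × Path d T)) (_ : IsBicausalCoupling μ ν π),
    ∫⁻ z, ENNReal.ofReal (pathNorm (z.1 - z.2)) ∂π

/-- The density `φ_σ` of `𝒩(0, σ² I_{dT})`. The exponent involves the Euclidean norm of `ℝ^{dT}`,
whose square is `∑_t ‖x_t‖²`. -/
noncomputable def gaussianDensity {d T : ℕ} (σ : ℝ) (x : Path d T) : ℝ :=
  (√((2 * Real.pi * σ ^ 2) ^ (d * T)))⁻¹ * Real.exp (-(∑ t, ‖x t‖ ^ 2) / (2 * σ ^ 2))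

/-- The Gaussian distribution `𝒩_σ = 𝒩(0, σ² I_{dT})` on the path space. -/
noncomputable def gaussian (d T : ℕ) (σ : ℝ) : Measure (Path d T) :=
  volume.withDensity fun x => ENNReal.ofReal (gaussianDensity σ x)

/-- The smoothed adapted Wasserstein distance `𝒜𝒲₁(μ ∗ 𝒩_σ, ν ∗ 𝒩_σ)`. -/
noncomputable def smoothedAdaptedWasserstein {d T : ℕ} (σ : ℝ) (μ ν : Measure (Path d T)) : ℝ≥0∞ :=
  adaptedWasserstein (μ.conv (gaussian d T σ)) (ν.conv (gaussian d T σ))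

/-- The empirical measure `N⁻¹ ∑_n δ_{x_n}` of the first `N` points of a sequence (for `N ≥ 1`). -/
noncomputable def empiricalMeasure {d T : ℕ} (N : ℕ) (x : ℕ → Path d T) : Measure (Path d T) :=
  (N : ℝ≥0∞)⁻¹ • ∑ n ∈ Finset.range N, Measure.dirac (x n)

/-- The `p`-th moment `M_p(μ) = ∫ ‖x‖^p dμ`. -/
noncomputable def moment {d T : ℕ} (p : ℝ) (μ : Measure (Path d T)) : ℝ :=
  ∫ x, pathNorm x ^ p ∂μ

/-- The constant `C_{σ,p,M_p}` built from `C₁`, `C₂`, with `M` in the place of `M_p`. -/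
noncomputable def meanConst (d T : ℕ) (C₁ C₂ σ p M : ℝ) : ℝ :=
  √(∫ x : Path d T, (pathNorm x + 1 / 2) ^ 2 / (1 + pathNorm x ^ p)) *
    √((C₁ * (2 ^ p * M + 1) + C₂ * 2 ^ p * σ ^ p) * (1 / (2 * Real.pi * σ) ^ (d * T)))

/-- The constant `c_{σ,K} = c₁ (sup_{x ∈ K} (1 + 2‖x‖) / (2σ) + 1)`. -/
noncomputable def deviationConst {d T : ℕ} (c₁ σ : ℝ) (K : Set (Path d T)) : ℝ :=
  c₁ * ((⨆ x : K, (1 + 2 * pathNorm (x : Path d T)) / (2 * σ)) + 1)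

/-- The (outer) expectation of a `[0, ∞]`-valued function, which is its expectation as soon as the
function is measurable (`expectation_eq_lintegral`). The lower Lebesgue integral `∫⁻` would give a
weaker upper bound for a function whose measurability has not been established. -/
noncomputable def expectation {Ω : Type*} [MeasurableSpace Ω] (P : Measure Ω) (f : Ω → ℝ≥0∞) :
    ℝ≥0∞ :=
  ⨅ (g : Ω → ℝ≥0∞) (_ : Measurable g) (_ : f ≤ g), ∫⁻ ω, g ω ∂P

theorem expectation_eq_lintegral {Ω : Type*} [MeasurableSpace Ω] (P : Measure Ω) {f : Ω → ℝ≥0∞}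
    (hf : Measurable f) : expectation P f = ∫⁻ ω, f ω ∂P :=
  le_antisymm (iInf_le_of_le f (iInf_le_of_le hf (iInf_le_of_le le_rfl le_rfl)))
    (le_iInf fun _ => le_iInf fun _ => le_iInf fun h => lintegral_mono h)

end AdaptedWasserstein

/-! After smoothing, both measures have strictly positive densities `f` and `g`, and the adapted
distance is controlled by a total variation distance with weight `‖x‖ + 1/2`: it is at most `A ∫
(‖x‖ + 1/2) |f - g|`, with `A` depending only on `d`, `T` and a radius of `K`
(`exists_smoothedAdaptedWasserstein_le`). Once this holds, only an explicit functional of a kernel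
density estimator has to be studied.

The comparison comes from a bicausal coupling built by induction on `T`. Given a coupling of the
pasts, the next points are drawn from the maximal coupling of the two conditional laws if the pasts
agree, and independently if they differ. The induction carries the cost `‖x - y‖ + 1_{x ≠ y}`: its
indicator pays for the independent draws, whose expected cost is bounded because the conditional
laws have uniformly bounded first moments. Indeed, a conditional law of a Gaussian mixture is again
a mixture of Gaussians with centres in the same ball, whatever the past. On equal pasts the cost is
the weighted total variation distance of the conditional densities, and integrated over the past it
is controlled by the distance of the joint densities (`mul_edelta_div_le`, `exists_bicausal_step`).

For the mean, the smoothed empirical density at a point `x` is an average of `N` independent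
variables `φ_σ(x - X_i)`, so its mean square error is at most `N⁻¹ ∫ φ_σ(x - a)² dμ(a)`. The
Cauchy-Schwarz inequality with weight `1 + ‖x‖^p` turns this into the rate `N^(-1/2)` with the
stated constant (`lintegral_empiricalDist_le`); `p > dT + 2` makes the dual weight integrable.

For the deviation, moving one sample point changes the weighted distance by at most `2W/N`, where
`W` is `weightBound`, so a bounded differences inequality gives a Gaussian tail with exponent `-N x²
/ (8 W²)` (`hasSubgaussianMGF_empiricalDist`). The constant `c₁` is chosen so that `c ≥ 3W`. -/

namespace AdaptedWasserstein

/-! ### Conditional kernels and disintegration -/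

section CondKernel

variable {α α' β β' γ δ : Type*} [MeasurableSpace α] [MeasurableSpace α'] [MeasurableSpace β]
  [MeasurableSpace β'] [MeasurableSpace γ] [MeasurableSpace δ]

/-- Tested on functions, the disintegration sees the conditioning variable only through the values
`X a`, so that relabelling it becomes a substitution. -/
theorem isCondKernel_iff_lintegral {m : Measure α} [SFinite m] {X : α → β} {Y : α → γ}
    (hX : Measurable X) (hY : Measurable Y) {κ : Kernel β γ} [IsMarkovKernel κ] :
    IsCondKernel m X Y κ ↔ ∀ F : β × γ → ℝ≥0∞, Measurable F →
      ∫⁻ a, F (X a, Y a) ∂m = ∫⁻ a, ∫⁻ y, F (X a, y) ∂(κ (X a)) ∂m := by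
  have h1 : ∀ F : β × γ → ℝ≥0∞, Measurable F →
      ∫⁻ p, F p ∂((m.map X) ⊗ₘ κ) = ∫⁻ a, ∫⁻ y, F (X a, y) ∂(κ (X a)) ∂m := by
    intro F hF
    rw [Measure.lintegral_compProd hF, lintegral_map (hF.lintegral_kernel_prod_right') hX]
  constructor
  · rintro ⟨-, h⟩ F hF
    rw [← h1 F hF, ← h, lintegral_map hF (hX.prodMk hY)]
  · intro h
    refine ⟨inferInstance, Measure.ext_of_lintegral _ fun F hF => ?_⟩
    rw [h1 F hF, lintegral_map hF (hX.prodMk hY), h F hF]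

/-- A conditional kernel given `X` is a conditional kernel given any `X'` that carries the same
information as `X`. -/
theorem IsCondKernel.relabel {m : Measure α} [SFinite m] {X : α → β} {Y : α → γ}
    (hX : Measurable X) (hY : Measurable Y) {κ : Kernel β γ} (h : IsCondKernel m X Y κ)
    {X' : α → β'} {j : β → β'} {r : β' → β} (hj : Measurable j) (hr : Measurable r)
    (hjX : ∀ a, j (X a) = X' a) (hrX : ∀ a, r (X' a) = X a) :
    IsCondKernel m X' Y (κ.comap r hr) := by
  have := h.1
  have hX' : X' = j ∘ X := funext fun a => (hjX a).symm
  have hX'm : Measurable X' := hX' ▸ hj.comp hX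
  rw [isCondKernel_iff_lintegral hX'm hY]
  rw [isCondKernel_iff_lintegral hX hY] at h
  intro F hF
  have := h (fun p => F (j p.1, p.2)) (by fun_prop)
  simpa only [hjX, hrX, Kernel.comap_apply] using this

theorem IsCondKernel.comp_map {m : Measure α'} {φ : α' → α} (hφ : Measurable φ) {X : α → β}
    {Y : α → γ} (hX : Measurable X) (hY : Measurable Y) {κ : Kernel β γ}
    (h : IsCondKernel (m.map φ) X Y κ) :
    IsCondKernel m (fun a => X (φ a)) (fun a => Y (φ a)) κ := by
  refine ⟨h.1, ?_⟩
  have h2 := h.2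
  rw [Measure.map_map (by fun_prop) hφ, Measure.map_map hX hφ] at h2
  exact h2

/-- Applied with `a` and `b` coordinate projections, this passes from marginals of the step kernel
to marginals of the extended coupling. -/
theorem map_prodMap_compProd {π : Measure α} [SFinite π] {κ : Kernel α γ} [IsSFiniteKernel κ]
    {η : Kernel β δ} [IsSFiniteKernel η] {a : α → β} (ha : Measurable a) {b : γ → δ}
    (hb : Measurable b) (h : ∀ z, (κ z).map b = η (a z)) :
    (π ⊗ₘ κ).map (fun q => (a q.1, b q.2)) = (π.map a) ⊗ₘ η := by
  refine Measure.ext_of_lintegral _ fun F hF => ?_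
  rw [lintegral_map hF (by fun_prop), Measure.lintegral_compProd (by fun_prop),
    Measure.lintegral_compProd hF, lintegral_map (hF.lintegral_kernel_prod_right') ha]
  refine lintegral_congr fun z => ?_
  rw [← h z, lintegral_map (by fun_prop) hb]

end CondKernel

/-! ### Appending one time step to a bicausal coupling -/

section Step

variable {d T : ℕ}

/-- Splitting off the last point of a path. -/
noncomputable def splitLast (d T : ℕ) : Path d (T + 1) ≃ᵐ Path d T × EuclideanSpace ℝ (Fin d) :=
  (MeasurableEquiv.piFinSuccAbove (fun _ => EuclideanSpace ℝ (Fin d)) (Fin.last T)).trans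
    MeasurableEquiv.prodComm

theorem splitLast_apply (x : Path d (T + 1)) :
    splitLast d T x = (fun j => x j.castSucc, x (Fin.last T)) := by
  simp only [splitLast, MeasurableEquiv.trans_apply, MeasurableEquiv.piFinSuccAbove_apply]
  ext1
  · funext j
    simp [Fin.insertNthEquiv, MeasurableEquiv.prodComm, Fin.init]
  · simp [Fin.insertNthEquiv, MeasurableEquiv.prodComm]

@[simp] theorem splitLast_symm_castSucc (p : Path d T × EuclideanSpace ℝ (Fin d)) (j : Fin T) :
    (splitLast d T).symm p j.castSucc = p.1 j := by
  have := congrArg Prod.fst ((splitLast_apply ((splitLast d T).symm p)).symm.trans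
    ((splitLast d T).apply_symm_apply p))
  exact congrFun this j

@[simp] theorem splitLast_symm_last (p : Path d T × EuclideanSpace ℝ (Fin d)) :
    (splitLast d T).symm p (Fin.last T) = p.2 :=
  congrArg Prod.snd ((splitLast_apply ((splitLast d T).symm p)).symm.trans
    ((splitLast d T).apply_symm_apply p))

theorem measurePreserving_splitLast : MeasurePreserving (splitLast d T) volume volume :=
  Measure.measurePreserving_swap.comp
    (volume_preserving_piFinSuccAbove (fun _ => EuclideanSpace ℝ (Fin d)) (Fin.last T))

theorem measurable_past {t : Fin T} : Measurable (past (d := d) t) :=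
  measurable_pi_iff.2 fun s => measurable_pi_apply (s : Fin T)

/-- Forgetting the last point of a path. -/
def initPath (x : Path d (T + 1)) : Path d T := fun j => x j.castSucc

theorem measurable_initPath : Measurable (initPath (d := d) (T := T)) :=
  measurable_pi_iff.2 fun j => measurable_pi_apply j.castSucc

/-- Passing from the past of a long path to the past of the shortened path. -/
def pastRestrict (s : Fin T) (p : {r : Fin (T + 1) // r < s.castSucc} → EuclideanSpace ℝ (Fin d)) :
    {r : Fin T // r < s} → EuclideanSpace ℝ (Fin d) :=
  fun r => p ⟨r.1.castSucc, Fin.castSucc_lt_castSucc_iff.2 r.2⟩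

theorem measurable_pastRestrict (s : Fin T) : Measurable (pastRestrict (d := d) s) :=
  measurable_pi_iff.2 fun _ => measurable_pi_apply _

/-- The inverse of `pastRestrict`. -/
def pastExtend (s : Fin T) (p : {r : Fin T // r < s} → EuclideanSpace ℝ (Fin d)) :
    {r : Fin (T + 1) // r < s.castSucc} → EuclideanSpace ℝ (Fin d) :=
  fun r => p ⟨r.1.castLT (lt_of_lt_of_le (show r.1.1 < s.1 from r.2) s.2.le), r.2⟩

theorem measurable_pastExtend (s : Fin T) : Measurable (pastExtend (d := d) s) :=
  measurable_pi_iff.2 fun _ => measurable_pi_apply _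

/-- The past before the last time, as a path. -/
def pastLastToPath (p : {r : Fin (T + 1) // r < Fin.last T} → EuclideanSpace ℝ (Fin d)) :
    Path d T := fun r => p ⟨r.castSucc, Fin.castSucc_lt_last r⟩

theorem measurable_pastLastToPath : Measurable (pastLastToPath (d := d) (T := T)) :=
  measurable_pi_iff.2 fun _ => measurable_pi_apply _

/-- A path, as the past before the last time of a longer path. -/
def pathToPastLast (p : Path d T) : {r : Fin (T + 1) // r < Fin.last T} → EuclideanSpace ℝ (Fin d) :=
  fun r => p (r.1.castLT r.2)

theorem measurable_pathToPastLast : Measurable (pathToPastLast (d := d) (T := T)) :=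
  measurable_pi_iff.2 fun _ => measurable_pi_apply _

/-- A conditional law at a time before the last does not involve the last point; only the index type
of the past changes, by a bijection. -/
theorem isCondKernel_castSucc {μ : Measure (Path d (T + 1))} [SFinite μ] (s : Fin T)
    {κ : Kernel ({r : Fin T // r < s} → EuclideanSpace ℝ (Fin d)) (EuclideanSpace ℝ (Fin d))}
    (h : IsCondKernel (μ.map initPath) (past s) (fun x => x s) κ) :
    IsCondKernel μ (past s.castSucc) (fun x => x s.castSucc)
      (κ.comap (pastRestrict s) (measurable_pastRestrict s)) :=
  IsCondKernel.relabel (measurable_past.comp measurable_initPath) (measurable_pi_apply _)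
    (h.comp_map measurable_initPath measurable_past (measurable_pi_apply _))
    (measurable_pastExtend s) (measurable_pastRestrict s) (fun _ => rfl) (fun _ => rfl)

theorem isCondKernel_last {μ : Measure (Path d (T + 1))} [SFinite μ] {μ' : Measure (Path d T)}
    [SFinite μ'] {κ : Kernel (Path d T) (EuclideanSpace ℝ (Fin d))} [IsMarkovKernel κ]
    (h : μ.map (splitLast d T) = μ' ⊗ₘ κ) :
    IsCondKernel μ (past (Fin.last T)) (fun x => x (Fin.last T))
      (κ.comap pastLastToPath measurable_pastLastToPath) := by
  have h' : μ.map (fun x => (initPath x, x (Fin.last T))) = μ' ⊗ₘ κ := by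
    rw [← h]; congr 1; funext x; exact (splitLast_apply x).symm
  have h1 : μ.map initPath = μ' := by
    have := congrArg (fun m => m.map Prod.fst) h'
    beta_reduce at this
    rw [Measure.map_map measurable_fst
      (measurable_initPath.prodMk (measurable_pi_apply _))] at this
    rw [show initPath = Prod.fst ∘ fun x : Path d (T + 1) => (initPath x, x (Fin.last T)) from rfl,
      this]
    exact Measure.fst_compProd _ _
  have h2 : IsCondKernel μ initPath (fun x => x (Fin.last T)) κ :=
    ⟨inferInstance, by rw [h', h1]⟩
  exact h2.relabel measurable_initPath (measurable_pi_apply _) measurable_pathToPastLast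
    measurable_pastLastToPath (fun _ => rfl) (fun _ => rfl)

/-- Appending a pair of points to a pair of paths. -/
noncomputable def joinPair
    (q : (Path d T × Path d T) × (EuclideanSpace ℝ (Fin d) × EuclideanSpace ℝ (Fin d))) :
    Path d (T + 1) × Path d (T + 1) :=
  ((splitLast d T).symm (q.1.1, q.2.1), (splitLast d T).symm (q.1.2, q.2.2))

theorem measurable_joinPair : Measurable (joinPair (d := d) (T := T)) := by
  unfold joinPair
  exact ((splitLast d T).symm.measurable.comp (by fun_prop)).prodMk
    ((splitLast d T).symm.measurable.comp (by fun_prop))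

theorem initPath_symm (p : Path d T × EuclideanSpace ℝ (Fin d)) :
    initPath ((splitLast d T).symm p) = p.1 := by
  funext j; simp [initPath]

/-- Extending a bicausal coupling by one time step. -/
theorem IsBicausalCoupling.step {μ ν : Measure (Path d (T + 1))} {μ' ν' : Measure (Path d T)}
    [IsProbabilityMeasure μ] [IsProbabilityMeasure ν]
    [IsProbabilityMeasure μ'] [IsProbabilityMeasure ν']
    {κμ κν : Kernel (Path d T) (EuclideanSpace ℝ (Fin d))} [IsMarkovKernel κμ] [IsMarkovKernel κν]
    (hμ : μ.map (splitLast d T) = μ' ⊗ₘ κμ) (hν : ν.map (splitLast d T) = ν' ⊗ₘ κν)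
    {π : Measure (Path d T × Path d T)} [IsProbabilityMeasure π]
    (hπ : IsBicausalCoupling μ' ν' π)
    {κ : Kernel (Path d T × Path d T) (EuclideanSpace ℝ (Fin d) × EuclideanSpace ℝ (Fin d))}
    [IsMarkovKernel κ] (hκ : ∀ z, IsCoupling (κμ z.1) (κν z.2) (κ z)) :
    IsBicausalCoupling μ ν ((π ⊗ₘ κ).map joinPair) := by
  have hinit : ∀ {m : Measure (Path d (T + 1))} {m' : Measure (Path d T)} [IsProbabilityMeasure m']
      {η : Kernel (Path d T) (EuclideanSpace ℝ (Fin d))} [IsMarkovKernel η],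
      m.map (splitLast d T) = m' ⊗ₘ η → m.map initPath = m' := by
    intro m m' _ η _ h
    have : (initPath : Path d (T + 1) → Path d T) = Prod.fst ∘ splitLast d T := by
      funext x; rw [Function.comp_apply, splitLast_apply]; rfl
    rw [this, ← Measure.map_map measurable_fst (splitLast d T).measurable, h]
    exact Measure.fst_compProd _ _
  have hback : ∀ {m : Measure (Path d (T + 1))} {n : Measure (Path d T × _)},
      m.map (splitLast d T) = n → m = n.map (splitLast d T).symm := by
    intro m n h
    rw [← h, Measure.map_map (splitLast d T).symm.measurable (splitLast d T).measurable]
    simp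
  -- Forgetting the last points gives back `π`, so bicausality at earlier times is inherited from
  -- `hπ`; only the last time needs `hκ`.
  have hpair : ((π ⊗ₘ κ).map joinPair).map (fun z => (initPath z.1, initPath z.2)) = π := by
    rw [Measure.map_map (by have := measurable_initPath (d := d) (T := T); fun_prop)
      measurable_joinPair]
    have : ((fun z : Path d (T + 1) × Path d (T + 1) => (initPath z.1, initPath z.2)) ∘ joinPair)
        = Prod.fst := by
      funext q; simp [joinPair, initPath_symm]
    rw [this]
    exact Measure.fst_compProd _ _
  have hm2 : Measurable (fun z : Path d (T + 1) × Path d (T + 1) => (initPath z.1, initPath z.2)) :=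
    by have := measurable_initPath (d := d) (T := T); fun_prop
  have := measurable_joinPair (d := d) (T := T)
  have : IsProbabilityMeasure ((π ⊗ₘ κ).map joinPair) :=
    Measure.isProbabilityMeasure_map measurable_joinPair.aemeasurable
  obtain ⟨⟨hc1, hc2⟩, hbc⟩ := hπ
  refine ⟨⟨?_, ?_⟩, fun t => ?_⟩
  · rw [hback hμ, Measure.map_map measurable_fst measurable_joinPair, ← hc1,
      ← map_prodMap_compProd measurable_fst measurable_fst (fun z => (hκ z).1),
      Measure.map_map (splitLast d T).symm.measurable (by fun_prop)]
    rfl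
  · rw [hback hν, Measure.map_map measurable_snd measurable_joinPair, ← hc2,
      ← map_prodMap_compProd measurable_snd measurable_snd (fun z => (hκ z).2),
      Measure.map_map (splitLast d T).symm.measurable (by fun_prop)]
    rfl
  · refine Fin.lastCases ?_ (fun s => ?_) t
    · refine ⟨κμ.comap pastLastToPath measurable_pastLastToPath,
        κν.comap pastLastToPath measurable_pastLastToPath,
        κ.comap (fun p => (pastLastToPath p.1, pastLastToPath p.2))
          (by have := measurable_pastLastToPath (d := d) (T := T); fun_prop),
        isCondKernel_last hμ, isCondKernel_last hν, ?_, ae_of_all _ fun z => hκ _⟩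
      have h2 : IsCondKernel ((π ⊗ₘ κ).map joinPair) (fun z => (initPath z.1, initPath z.2))
          (fun z => (z.1 (Fin.last T), z.2 (Fin.last T))) κ := by
        refine ⟨inferInstance, ?_⟩
        rw [hpair, Measure.map_map (hm2.prodMk (by fun_prop)) measurable_joinPair]
        convert Measure.map_id using 2
        funext q
        simp [joinPair, initPath_symm]
      exact h2.relabel hm2 (by fun_prop)
        (j := fun p => (pathToPastLast p.1, pathToPastLast p.2))
        (by have := measurable_pathToPastLast (d := d) (T := T); fun_prop) _
        (fun _ => rfl) (fun _ => rfl)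
    · obtain ⟨κ₁, κ₂, κ₃, h1, h2, h3, h4⟩ := hbc s
      rw [← hinit hμ] at h1
      rw [← hinit hν] at h2
      rw [← hpair] at h3 h4
      have hps := measurable_past (d := d) (t := s)
      refine ⟨_, _, κ₃.comap (fun p => (pastRestrict s p.1, pastRestrict s p.2))
          (by have := measurable_pastRestrict (d := d) s; fun_prop),
        isCondKernel_castSucc s h1, isCondKernel_castSucc s h2, ?_, ae_of_ae_map hm2.aemeasurable h4⟩
      exact (h3.comp_map hm2 (by fun_prop) (by fun_prop)).relabel
        (X := fun z => (past s (initPath z.1), past s (initPath z.2)))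
        (by have := measurable_initPath (d := d) (T := T); fun_prop) (by fun_prop)
        (j := fun p => (pastExtend s p.1, pastExtend s p.2))
        (by have := measurable_pastExtend (d := d) s; fun_prop) _
        (fun _ => rfl) (fun _ => rfl)

end Step

end AdaptedWasserstein

namespace AdaptedWasserstein

/-! ### Maximal couplings of probability densities, measurable in a parameter -/

section MaximalCoupling

variable {α β : Type*} [MeasurableSpace α] [MeasurableSpace β] {ρ : Measure β}

/-- The kernel with densities `f h` with respect to a fixed measure `ρ`. -/
noncomputable def densityKernel (ρ : Measure β) [SFinite ρ] (f : α → β → ℝ≥0∞) : Kernel α β :=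
  Kernel.withDensity (Kernel.const α ρ) f

/-- Either excess completes the common mass `∫ min (f h) (g h)` to total mass one. -/
theorem lintegral_sub_comm_of_lintegral_eq_one {f g : α → β → ℝ≥0∞}
    (hf : Measurable (Function.uncurry f)) (hg : Measurable (Function.uncurry g)) (hf1 : ∀ h, ∫⁻ x, f h x ∂ρ = 1)
    (hg1 : ∀ h, ∫⁻ x, g h x ∂ρ = 1) (h : α) :
    ∫⁻ x, f h x - g h x ∂ρ = ∫⁻ x, g h x - f h x ∂ρ := by
  have hfh : Measurable (f h) := hf.of_uncurry_left
  have hgh : Measurable (g h) := hg.of_uncurry_left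
  have h1 : ∫⁻ x, f h x - g h x ∂ρ + ∫⁻ x, min (f h x) (g h x) ∂ρ = 1 := by
    rw [← lintegral_add_left (by fun_prop), ← hf1 h]
    exact lintegral_congr fun x => tsub_add_min
  have h2 : ∫⁻ x, g h x - f h x ∂ρ + ∫⁻ x, min (f h x) (g h x) ∂ρ = 1 := by
    rw [← lintegral_add_left (by fun_prop), ← hg1 h]
    refine lintegral_congr fun x => ?_
    rw [min_comm, tsub_add_min]
  have h3 : ∫⁻ x, min (f h x) (g h x) ∂ρ ≠ ∞ := fun h' => by simp [h'] at h1
  exact (ENNReal.add_left_inj h3).1 (h1.trans h2.symm)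

variable [SFinite ρ]

theorem lintegral_densityKernel {f : α → β → ℝ≥0∞} (hf : Measurable (Function.uncurry f)) (h : α)
    {F : β → ℝ≥0∞} (hF : Measurable F) :
    ∫⁻ x, F x ∂(densityKernel ρ f h) = ∫⁻ x, f h x * F x ∂ρ := by
  rw [densityKernel, Kernel.lintegral_withDensity _ hf _ hF, Kernel.const_apply]

theorem isMarkovKernel_densityKernel {f : α → β → ℝ≥0∞} (hf : Measurable (Function.uncurry f))
    (hf1 : ∀ h, ∫⁻ x, f h x ∂ρ = 1) : IsMarkovKernel (densityKernel ρ f) := by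
  refine ⟨fun h => ⟨?_⟩⟩
  rw [← lintegral_one, lintegral_densityKernel hf h measurable_const]
  simpa using hf1 h

theorem isSFiniteKernel_densityKernel {f : α → β → ℝ≥0∞} (hf : ∀ h x, f h x ≠ ∞) :
    IsSFiniteKernel (densityKernel ρ f) :=
  Kernel.IsSFiniteKernel.withDensity _ hf

/-- The symmetric difference `|a - b|` of extended nonnegative reals. -/
noncomputable def edelta (a b : ℝ≥0∞) : ℝ≥0∞ := (a - b) + (b - a)

/-- The maximal coupling of the probability densities `f h` and `g h`. -/
noncomputable def maxCoupling (ρ : Measure β) [SFinite ρ] (f g : α → β → ℝ≥0∞) :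
    Kernel α (β × β) :=
  Kernel.map (densityKernel ρ fun h x => min (f h x) (g h x)) (fun x => (x, x)) +
    Kernel.withDensity
      (densityKernel ρ (fun h x => f h x - g h x) ×ₖ densityKernel ρ fun h x => g h x - f h x)
      (fun h _ => (∫⁻ x, f h x - g h x ∂ρ)⁻¹)

variable {f g : α → β → ℝ≥0∞} (hf : Measurable (Function.uncurry f))
  (hg : Measurable (Function.uncurry g)) (hft : ∀ h x, f h x ≠ ∞) (hgt : ∀ h x, g h x ≠ ∞)
  (hf1 : ∀ h, ∫⁻ x, f h x ∂ρ = 1) (hg1 : ∀ h, ∫⁻ x, g h x ∂ρ = 1)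

include hf hg hft hgt in
theorem lintegral_maxCoupling (h : α) {F : β × β → ℝ≥0∞} (hF : Measurable F) :
    ∫⁻ z, F z ∂(maxCoupling ρ f g h) = ∫⁻ x, min (f h x) (g h x) * F (x, x) ∂ρ +
      (∫⁻ x, f h x - g h x ∂ρ)⁻¹ *
        ∫⁻ x, (f h x - g h x) * ∫⁻ y, (g h y - f h y) * F (x, y) ∂ρ ∂ρ := by
  have i1 : IsSFiniteKernel (densityKernel ρ fun h x => f h x - g h x) :=
    isSFiniteKernel_densityKernel fun h x => ENNReal.sub_ne_top (hft h x)
  have i2 : IsSFiniteKernel (densityKernel ρ fun h x => g h x - f h x) :=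
    isSFiniteKernel_densityKernel fun h x => ENNReal.sub_ne_top (hgt h x)
  have hm : Measurable fun h => (∫⁻ x, f h x - g h x ∂ρ)⁻¹ :=
    (Measurable.lintegral_prod_right' (f := fun p : α × β => f p.1 p.2 - g p.1 p.2)
      (hf.sub hg)).inv
  have hm' : Measurable (Function.uncurry fun (h : α) (_ : β × β) => (∫⁻ x, f h x - g h x ∂ρ)⁻¹) :=
    hm.comp measurable_fst
  have hin : Measurable fun x => ∫⁻ y, (g h y - f h y) * F (x, y) ∂ρ := by
    have hfh : Measurable (f h) := hf.of_uncurry_left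
    have hgh : Measurable (g h) := hg.of_uncurry_left
    exact Measurable.lintegral_prod_right' (f := fun p : β × β => (g h p.2 - f h p.2) * F p)
      (by fun_prop)
  rw [maxCoupling, _root_.add_apply, lintegral_add_measure,
    Kernel.map_apply _ (by fun_prop), lintegral_map hF (by fun_prop),
    lintegral_densityKernel (hf.min hg) h (by fun_prop),
    Kernel.lintegral_withDensity _ hm' h hF, lintegral_const_mul _ hF,
    Kernel.lintegral_prod _ _ _ hF]
  congr 2
  refine Eq.trans ?_ (lintegral_densityKernel (f := fun h x => f h x - g h x) (hf.sub hg) h hin)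
  refine lintegral_congr fun x => ?_
  exact lintegral_densityKernel (f := fun h x => g h x - f h x) (hg.sub hf) h (by fun_prop)

include hf hg hft hgt hf1 hg1 in
-- In each coordinate the diagonal part contributes `min (f h) (g h)`, and the normalised product of
-- the excesses contributes the missing excess. The symmetric claim `key` serves both marginals.
theorem isCoupling_maxCoupling (h : α) :
    IsCoupling (densityKernel ρ f h) (densityKernel ρ g h) (maxCoupling ρ f g h) := by
  have hfh : Measurable (f h) := hf.of_uncurry_left
  have hgh : Measurable (g h) := hg.of_uncurry_left
  have hsym := lintegral_sub_comm_of_lintegral_eq_one hf hg hf1 hg1 h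
  set m := ∫⁻ x, f h x - g h x ∂ρ with hm
  have hmt : m ≠ ∞ := by
    refine ((lintegral_mono fun x => tsub_le_self).trans_lt ?_).ne
    rw [hf1 h]; exact ENNReal.one_lt_top
  have key : ∀ (a b : β → ℝ≥0∞), Measurable a → Measurable b → ∫⁻ x, a x - b x ∂ρ = m →
      ∀ F : β → ℝ≥0∞, Measurable F →
      ∫⁻ x, min (a x) (b x) * F x ∂ρ + m⁻¹ * (m * ∫⁻ x, (a x - b x) * F x ∂ρ)
        = ∫⁻ x, a x * F x ∂ρ := by
    intro a b ha hb hab F hF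
    have hcancel : m⁻¹ * (m * ∫⁻ x, (a x - b x) * F x ∂ρ) = ∫⁻ x, (a x - b x) * F x ∂ρ := by
      -- For equal densities `m⁻¹ = ∞`, but the excess then vanishes almost everywhere and `∞ * 0 =
      -- 0` gives the right value.
      by_cases h0 : m = 0
      · have : (fun x => a x - b x) =ᵐ[ρ] 0 := by
          rw [← lintegral_eq_zero_iff (by fun_prop), hab, h0]
        have h2 : ∫⁻ x, (a x - b x) * F x ∂ρ = 0 := by
          rw [lintegral_eq_zero_iff (by fun_prop)]
          filter_upwards [this] with x hx
          simp only [Pi.zero_apply] at hx ⊢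
          rw [hx, zero_mul]
        rw [h2, mul_zero, mul_zero]
      · rw [← mul_assoc, ENNReal.inv_mul_cancel h0 hmt, one_mul]
    rw [hcancel, ← lintegral_add_left (by fun_prop)]
    refine lintegral_congr fun x => ?_
    rw [← add_mul, add_comm, tsub_add_min]
  constructor
  · refine Measure.ext_of_lintegral _ fun F hF => ?_
    rw [lintegral_map hF measurable_fst, lintegral_maxCoupling hf hg hft hgt h (by fun_prop),
      lintegral_densityKernel hf h hF, ← key (f h) (g h) hfh hgh rfl F hF]
    congr 2
    simp only
    rw [← lintegral_const_mul _ (by fun_prop)]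
    refine lintegral_congr fun x => ?_
    rw [lintegral_mul_const _ (by fun_prop), ← hsym]
    ring
  · refine Measure.ext_of_lintegral _ fun F hF => ?_
    rw [lintegral_map hF measurable_snd, lintegral_maxCoupling hf hg hft hgt h (by fun_prop),
      lintegral_densityKernel hg h hF, ← key (g h) (f h) hgh hfh hsym.symm F hF]
    congr 2
    · simp_rw [min_comm]
    · simp only
      rw [lintegral_mul_const _ (by fun_prop)]

include hf hg hft hgt hf1 hg1 in
/-- The cost of the maximal coupling is controlled by the weighted total variation distance. -/
theorem lintegral_maxCoupling_le (h : α) {c : β × β → ℝ≥0∞} (hc : Measurable c) {w : β → ℝ≥0∞}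
    (hw : Measurable w) (hdiag : ∀ x, c (x, x) = 0) (hcw : ∀ x y, c (x, y) ≤ w x + w y) :
    ∫⁻ z, c z ∂(maxCoupling ρ f g h) ≤ ∫⁻ x, w x * edelta (f h x) (g h x) ∂ρ := by
  have hfh : Measurable (f h) := hf.of_uncurry_left
  have hgh : Measurable (g h) := hg.of_uncurry_left
  have hsym := lintegral_sub_comm_of_lintegral_eq_one hf hg hf1 hg1 h
  rw [lintegral_maxCoupling hf hg hft hgt h hc]
  simp only [hdiag, mul_zero, lintegral_zero, zero_add]
  set m := ∫⁻ x, f h x - g h x ∂ρ with hm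
  calc m⁻¹ * ∫⁻ x, (f h x - g h x) * ∫⁻ y, (g h y - f h y) * c (x, y) ∂ρ ∂ρ
      ≤ m⁻¹ * ∫⁻ x, (f h x - g h x) * ∫⁻ y, (g h y - f h y) * (w x + w y) ∂ρ ∂ρ := by
        gcongr; exact hcw _ _
    _ = m⁻¹ * (m * ∫⁻ x, w x * edelta (f h x) (g h x) ∂ρ) := by
        congr 1
        -- In each of the two terms of `w x + w y`, the variable that is not weighted integrates to
        -- `m`; the two weighted excesses add up to `w * edelta`.
        have : ∀ x, (f h x - g h x) * ∫⁻ y, (g h y - f h y) * (w x + w y) ∂ρ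
            = m * (w x * (f h x - g h x)) +
              (f h x - g h x) * ∫⁻ y, (g h y - f h y) * w y ∂ρ := by
          intro x
          simp_rw [mul_add]
          rw [lintegral_add_left (by fun_prop), lintegral_mul_const _ (by fun_prop), ← hsym]
          ring
        simp_rw [this]
        rw [lintegral_add_left (by fun_prop), lintegral_const_mul _ (by fun_prop),
          lintegral_mul_const _ (by fun_prop), ← hm, ← mul_add, ← lintegral_add_left (by fun_prop)]
        congr 1
        refine lintegral_congr fun x => ?_
        rw [edelta]; ring
    _ ≤ ∫⁻ x, w x * edelta (f h x) (g h x) ∂ρ := by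
        rw [← mul_assoc]
        exact mul_le_of_le_one_left zero_le (ENNReal.inv_mul_le_one m)

include hf hg hft hgt hf1 hg1 in
/-- A measurable choice of couplings of `f h` and `g h'` which is maximal for `h = h'`. -/
theorem exists_coupling_kernel [MeasurableEq α] :
    ∃ κ : Kernel (α × α) (β × β), IsMarkovKernel κ ∧
      (∀ z, IsCoupling (densityKernel ρ f z.1) (densityKernel ρ g z.2) (κ z)) ∧
      ∀ (c : β × β → ℝ≥0∞) (w : β → ℝ≥0∞), Measurable c → Measurable w → (∀ x, c (x, x) = 0) →
        (∀ x y, c (x, y) ≤ w x + w y) →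
        ∀ h, ∫⁻ z, c z ∂(κ (h, h)) ≤ ∫⁻ x, w x * edelta (f h x) (g h x) ∂ρ := by
  classical
  have := isMarkovKernel_densityKernel hf hf1
  have := isMarkovKernel_densityKernel hg hg1
  -- Maximal coupling on the diagonal, independent coupling off it; measurability of the diagonal
  -- makes this a kernel.
  let κ : Kernel (α × α) (β × β) := Kernel.piecewise (measurableSet_diagonal (α := α))
    ((maxCoupling ρ f g).comap Prod.fst measurable_fst)
    ((densityKernel ρ f).comap Prod.fst measurable_fst ×ₖ
      (densityKernel ρ g).comap Prod.snd measurable_snd)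
  have hκ : ∀ z, IsCoupling (densityKernel ρ f z.1) (densityKernel ρ g z.2) (κ z) := by
    rintro ⟨h, h'⟩
    simp only [κ, Kernel.piecewise_apply, Kernel.comap_apply, Kernel.prod_apply, Set.mem_diagonal_iff]
    split_ifs with heq
    · subst heq
      exact isCoupling_maxCoupling hf hg hft hgt hf1 hg1 h
    · exact ⟨by simp, by simp⟩
  refine ⟨κ, ⟨fun z => ⟨?_⟩⟩, hκ, fun c w hc hw hd hcw h => ?_⟩
  · have h1 := congrArg (fun m => m Set.univ) (hκ z).1
    simpa [Measure.map_apply measurable_fst MeasurableSet.univ] using h1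
  · simpa [κ, Kernel.piecewise_apply] using
      lintegral_maxCoupling_le hf hg hft hgt hf1 hg1 h hc hw hd hcw

end MaximalCoupling

end AdaptedWasserstein

/-! ### Weighted total variation and the cost of one step -/

namespace AdaptedWasserstein

variable {d T : ℕ}

theorem measurable_edelta {α : Type*} [MeasurableSpace α] {f g : α → ℝ≥0∞} (hf : Measurable f)
    (hg : Measurable g) : Measurable fun x => edelta (f x) (g x) := by
  unfold edelta; fun_prop

theorem measurable_pathNorm : Measurable (pathNorm (d := d) (T := T)) := by
  unfold pathNorm; fun_prop

theorem pathNorm_nonneg (x : Path d T) : 0 ≤ pathNorm x :=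
  Finset.sum_nonneg fun _ _ => norm_nonneg _

theorem pathNorm_splitLast_symm (p : Path d T × EuclideanSpace ℝ (Fin d)) :
    pathNorm ((splitLast d T).symm p) = pathNorm p.1 + ‖p.2‖ := by
  simp [pathNorm, Fin.sum_univ_castSucc]

theorem lintegral_path_succ {F : Path d (T + 1) → ℝ≥0∞} (hF : Measurable F) :
    ∫⁻ x, F x = ∫⁻ h : Path d T, ∫⁻ x, F ((splitLast d T).symm (h, x)) := by
  rw [← (measurePreserving_splitLast (d := d) (T := T)).symm.lintegral_comp hF]
  exact lintegral_prod _ (hF.comp (splitLast d T).symm.measurable).aemeasurable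

/-- The distance of two densities in total variation with weight `‖x‖ + 1/2`. -/
noncomputable def weightedDist (f g : Path d T → ℝ≥0∞) : ℝ≥0∞ :=
  ∫⁻ x, (ENNReal.ofReal (pathNorm x) + 1 / 2) * edelta (f x) (g x)

/-- The cost `‖x - y‖ + 1_{x ≠ y}`. -/
noncomputable def pathCost (z : Path d T × Path d T) : ℝ≥0∞ :=
  ENNReal.ofReal (pathNorm (z.1 - z.2)) + (Set.diagonal (Path d T))ᶜ.indicator 1 z

theorem measurable_pathCost : Measurable (pathCost (d := d) (T := T)) := by
  have := measurable_pathNorm (d := d) (T := T)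
  have h2 : Measurable fun z : Path d T × Path d T => z.1 - z.2 := by fun_prop
  exact ((this.comp h2).ennreal_ofReal).add
    (measurable_one.indicator measurableSet_diagonal.compl)

/-- The cost `‖x - y‖ + 1_{x ≠ y}` of a single time step. -/
noncomputable def pointCost (z : EuclideanSpace ℝ (Fin d) × EuclideanSpace ℝ (Fin d)) : ℝ≥0∞ :=
  ‖z.1 - z.2‖ₑ + (Set.diagonal (EuclideanSpace ℝ (Fin d)))ᶜ.indicator 1 z

theorem measurable_pointCost : Measurable (pointCost (d := d)) :=
  (by fun_prop : Measurable fun z : EuclideanSpace ℝ (Fin d) × EuclideanSpace ℝ (Fin d) =>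
    ‖z.1 - z.2‖ₑ).add (measurable_one.indicator measurableSet_diagonal.compl)

theorem pointCost_self (x : EuclideanSpace ℝ (Fin d)) : pointCost (x, x) = 0 := by
  simp [pointCost]

/-- This is the separable majorant required by `exists_coupling_kernel`. Bounding the indicator by
`1 + 1` is wasteful but affects only the constant `A`. -/
theorem pointCost_le (x y : EuclideanSpace ℝ (Fin d)) :
    pointCost (x, y) ≤ (‖x‖ₑ + 1) + (‖y‖ₑ + 1) := by
  have h1 : (Set.diagonal (EuclideanSpace ℝ (Fin d)))ᶜ.indicator
      (1 : EuclideanSpace ℝ (Fin d) × EuclideanSpace ℝ (Fin d) → ℝ≥0∞) (x, y) ≤ 1 :=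
    Set.indicator_le_self' (fun _ _ => zero_le) _
  calc pointCost (x, y) ≤ (‖x‖ₑ + ‖y‖ₑ) + (1 + 1) :=
        add_le_add enorm_sub_le (h1.trans le_self_add)
    _ = _ := by ring

/-- The sum-norm is additive in time, and extended paths can differ only if their pasts or their
last points do. -/
theorem pathCost_joinPair_le
    (q : (Path d T × Path d T) × (EuclideanSpace ℝ (Fin d) × EuclideanSpace ℝ (Fin d))) :
    pathCost (joinPair q) ≤ pathCost q.1 + pointCost q.2 := by
  obtain ⟨⟨h, h'⟩, x, y⟩ := q
  have e1 : pathNorm ((joinPair ((h, h'), (x, y))).1 - (joinPair ((h, h'), (x, y))).2)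
      = pathNorm (h - h') + ‖x - y‖ := by
    simp [pathNorm, Fin.sum_univ_castSucc, joinPair]
  have e2 : (Set.diagonal (Path d (T + 1)))ᶜ.indicator
      (1 : Path d (T + 1) × Path d (T + 1) → ℝ≥0∞) (joinPair ((h, h'), (x, y)))
      ≤ (Set.diagonal (Path d T))ᶜ.indicator 1 (h, h') +
        (Set.diagonal (EuclideanSpace ℝ (Fin d)))ᶜ.indicator 1 (x, y) := by
    by_cases hh : h = h'
    · by_cases hx : x = y
      · subst hh hx
        simp [joinPair]
      · refine le_trans (Set.indicator_le_self' (fun _ _ => zero_le) _) ?_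
        simp [hx]
    · refine le_trans (Set.indicator_le_self' (fun _ _ => zero_le) _) ?_
      simp [hh]
  unfold pathCost pointCost
  rw [e1, ENNReal.ofReal_add (pathNorm_nonneg _) (norm_nonneg _), ofReal_norm]
  calc _ ≤ ENNReal.ofReal (pathNorm (h - h')) + ‖x - y‖ₑ + _ := add_le_add le_rfl e2
    _ = _ := by ring

/-- The density of the law of a path without its last point. -/
noncomputable def marginalDensity (f : Path d (T + 1) → ℝ≥0∞) (h : Path d T) : ℝ≥0∞ :=
  ∫⁻ x, f ((splitLast d T).symm (h, x))

/-- The conditional density of the last point of a path, given its past. -/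
noncomputable def conditionalDensity (f : Path d (T + 1) → ℝ≥0∞) (h : Path d T)
    (x : EuclideanSpace ℝ (Fin d)) : ℝ≥0∞ :=
  f ((splitLast d T).symm (h, x)) / marginalDensity f h

theorem measurable_marginalDensity {f : Path d (T + 1) → ℝ≥0∞} (hf : Measurable f) :
    Measurable (marginalDensity f) :=
  Measurable.lintegral_prod_right' (f := fun p => f ((splitLast d T).symm p))
    (hf.comp (splitLast d T).symm.measurable)

theorem measurable_conditionalDensity {f : Path d (T + 1) → ℝ≥0∞} (hf : Measurable f) :
    Measurable (Function.uncurry (conditionalDensity f)) :=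
  (hf.comp (splitLast d T).symm.measurable).div ((measurable_marginalDensity hf).comp measurable_fst)

section OneDensity

variable {f : Path d (T + 1) → ℝ≥0∞} (hf : Measurable f) (hf0 : ∀ h, marginalDensity f h ≠ 0)
  (hft : ∀ h, marginalDensity f h ≠ ∞)

include hf hf0 hft in
theorem lintegral_conditionalDensity (h : Path d T) : ∫⁻ x, conditionalDensity f h x = 1 := by
  have : Measurable fun x => f ((splitLast d T).symm (h, x)) :=
    hf.comp ((splitLast d T).symm.measurable.comp (by fun_prop))
  simp only [conditionalDensity, div_eq_mul_inv]
  rw [lintegral_mul_const _ this]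
  exact ENNReal.mul_inv_cancel (hf0 h) (hft h)

include hf0 hft in
theorem marginalDensity_mul_conditionalDensity (h : Path d T) (x : EuclideanSpace ℝ (Fin d)) :
    marginalDensity f h * conditionalDensity f h x = f ((splitLast d T).symm (h, x)) :=
  ENNReal.mul_div_cancel (hf0 h) (hft h)

include hf hf0 hft in
-- The joint density is marginal times conditional at every past, without exceptional sets, because
-- the marginal density is nowhere `0` or `∞`.
theorem map_splitLast_withDensity :
    (volume.withDensity f).map (splitLast d T) =
      (volume.withDensity (marginalDensity f)) ⊗ₘ
        (densityKernel volume (conditionalDensity f)) := by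
  have := isMarkovKernel_densityKernel (ρ := volume) (measurable_conditionalDensity hf)
    (lintegral_conditionalDensity hf hf0 hft)
  have hm := measurable_marginalDensity hf
  have hc := measurable_conditionalDensity hf
  refine Measure.ext_of_lintegral _ fun F hF => ?_
  have hF' : Measurable fun h => ∫⁻ x, F (h, x) ∂(densityKernel volume (conditionalDensity f) h) :=
    hF.lintegral_kernel_prod_right'
  rw [lintegral_map hF (splitLast d T).measurable,
    lintegral_withDensity_eq_lintegral_mul _ hf (g := fun x => F (splitLast d T x))
      (hF.comp (splitLast d T).measurable),
    lintegral_path_succ (F := f * fun x => F (splitLast d T x))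
      (hf.mul (hF.comp (splitLast d T).measurable)),
    Measure.lintegral_compProd hF, lintegral_withDensity_eq_lintegral_mul _ hm hF']
  refine lintegral_congr fun h => ?_
  have hch : Measurable (conditionalDensity f h) := hc.of_uncurry_left
  simp only [Pi.mul_apply]
  rw [lintegral_densityKernel hc h (by fun_prop), ← lintegral_const_mul _ (by fun_prop)]
  refine lintegral_congr fun x => ?_
  rw [← mul_assoc, marginalDensity_mul_conditionalDensity hf0 hft]
  simp

end OneDensity

section TwoDensities

/-- Put `q = b / n`. Then `m (a/m - q) = (a - b) + (n - m) q` over the reals; truncated subtraction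
needs the two signs separately. -/
theorem mul_edelta_div_le {a b m n : ℝ≥0∞} (hm0 : m ≠ 0) (hm : m ≠ ∞) (hn0 : n ≠ 0) (hn : n ≠ ∞) :
    m * edelta (a / m) (b / n) ≤ edelta a b + edelta m n * (b / n) := by
  have hb : n * (b / n) = b := ENNReal.mul_div_cancel hn0 hn
  have ha : m * (a / m) = a := ENNReal.mul_div_cancel hm0 hm
  generalize b / n = q at *
  have h1 : m * (a / m - q) ≤ (a - b) + (n - m) * q := by
    rw [ENNReal.mul_sub (fun _ _ => hm), ha, tsub_le_iff_right]
    calc a ≤ (a - b) + b := le_tsub_add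
      _ = (a - b) + n * q := by rw [hb]
      _ ≤ (a - b) + ((n - m) + m) * q := by gcongr; exact le_tsub_add
      _ = _ := by ring
  have h2 : m * (q - a / m) ≤ (b - a) + (m - n) * q := by
    rw [ENNReal.mul_sub (fun _ _ => hm), ha, tsub_le_iff_right]
    calc m * q ≤ ((m - n) + n) * q := by gcongr; exact le_tsub_add
      _ = (m - n) * q + b := by rw [add_mul, hb]
      _ ≤ (m - n) * q + ((b - a) + a) := by gcongr; exact le_tsub_add
      _ = _ := by ring
  calc m * edelta (a / m) q = m * (a / m - q) + m * (q - a / m) := by rw [edelta, mul_add]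
    _ ≤ _ := add_le_add h1 h2
    _ = _ := by simp only [edelta]; ring

variable {f g : Path d (T + 1) → ℝ≥0∞} (hf : Measurable f) (hg : Measurable g)

include hf hg in
theorem edelta_marginalDensity_le (h : Path d T) :
    edelta (marginalDensity f h) (marginalDensity g h) ≤
      ∫⁻ x, edelta (f ((splitLast d T).symm (h, x))) (g ((splitLast d T).symm (h, x))) := by
  have hf' : Measurable fun x => f ((splitLast d T).symm (h, x)) :=
    hf.comp ((splitLast d T).symm.measurable.comp (by fun_prop))
  have hg' : Measurable fun x => g ((splitLast d T).symm (h, x)) :=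
    hg.comp ((splitLast d T).symm.measurable.comp (by fun_prop))
  simp only [edelta]
  rw [lintegral_add_left (by fun_prop)]
  exact add_le_add (lintegral_sub_le _ _ hg') (lintegral_sub_le _ _ hf')

include hf hg in
-- Integrating out the last point contracts total variation, and the weight of a path dominates that
-- of its initial part.
theorem weightedDist_marginalDensity_le :
    weightedDist (marginalDensity f) (marginalDensity g) ≤ weightedDist f g := by
  have := measurable_pathNorm (d := d) (T := T + 1)
  have hd := measurable_edelta hf hg
  unfold weightedDist
  rw [lintegral_path_succ (by fun_prop)]
  refine lintegral_mono fun h => ?_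
  calc _ ≤ (ENNReal.ofReal (pathNorm h) + 1 / 2) * ∫⁻ x, edelta
        (f ((splitLast d T).symm (h, x))) (g ((splitLast d T).symm (h, x))) := by
        gcongr; exact edelta_marginalDensity_le hf hg h
    _ = ∫⁻ x, (ENNReal.ofReal (pathNorm h) + 1 / 2) * edelta
        (f ((splitLast d T).symm (h, x))) (g ((splitLast d T).symm (h, x))) := by
        rw [lintegral_const_mul]
        exact hd.comp ((splitLast d T).symm.measurable.comp (by fun_prop))
    _ ≤ _ := by
        refine lintegral_mono fun x => ?_
        gcongr
        rw [pathNorm_splitLast_symm]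
        exact le_add_of_nonneg_right (norm_nonneg _)

variable (hf0 : ∀ h, marginalDensity f h ≠ 0) (hft : ∀ h, marginalDensity f h ≠ ∞)
  (hg0 : ∀ h, marginalDensity g h ≠ 0) (hgt : ∀ h, marginalDensity g h ≠ ∞)
  (hf' : ∀ x, f x ≠ ∞) (hg' : ∀ x, g x ≠ ∞) {B : ℝ≥0∞}
  (hfB : ∀ h, ∫⁻ x, ‖x‖ₑ * conditionalDensity f h x ≤ B)
  (hgB : ∀ h, ∫⁻ x, ‖x‖ₑ * conditionalDensity g h x ≤ B)

include hf hf0 hft hfB in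
theorem lintegral_weight_conditionalDensity_le (h : Path d T) :
    ∫⁻ x, (‖x‖ₑ + 1) * conditionalDensity f h x ≤ B + 1 := by
  have hc : Measurable (conditionalDensity f h) :=
    (measurable_conditionalDensity hf).of_uncurry_left
  simp_rw [add_mul, one_mul]
  rw [lintegral_add_right _ hc, lintegral_conditionalDensity hf hf0 hft]
  gcongr
  exact hfB h

include hf hg hf0 hft hg0 hgt hgB in
-- Multiplying by the marginal density of `f` undoes the division in the conditional density, up to
-- an error `|m_f - m_g|` times the conditional density of `g`. The weighted mass of the latter is
-- at most `B + 1`, which leaves the distance of the marginals.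
theorem lintegral_edelta_conditionalDensity_le :
    ∫⁻ h, ∫⁻ x, (‖x‖ₑ + 1) * edelta (conditionalDensity f h x) (conditionalDensity g h x)
      ∂volume ∂(volume.withDensity (marginalDensity f)) ≤ (2 + 2 * (B + 1)) * weightedDist f g := by
  have hpn := measurable_pathNorm (d := d) (T := T + 1)
  have hd := measurable_edelta hf hg
  have hmf := measurable_marginalDensity hf
  have hmg := measurable_marginalDensity hg
  have hcf := measurable_conditionalDensity hf
  have hcg := measurable_conditionalDensity hg
  have hmd := measurable_edelta hmf hmg
  have hD : Measurable fun h : Path d T => ∫⁻ x, (‖x‖ₑ + 1) *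
      edelta (conditionalDensity f h x) (conditionalDensity g h x) := by
    have := measurable_edelta hcf hcg
    exact Measurable.lintegral_prod_right'
      (f := fun p : Path d T × EuclideanSpace ℝ (Fin d) => (‖p.2‖ₑ + 1) *
        edelta (conditionalDensity f p.1 p.2) (conditionalDensity g p.1 p.2))
      ((by fun_prop : Measurable fun p : Path d T × EuclideanSpace ℝ (Fin d) => ‖p.2‖ₑ + 1).mul this)
  have hdh : ∀ h, Measurable fun x =>
      edelta (f ((splitLast d T).symm (h, x))) (g ((splitLast d T).symm (h, x))) := fun h =>
    hd.comp ((splitLast d T).symm.measurable.comp (by fun_prop))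
  rw [lintegral_withDensity_eq_lintegral_mul _ hmf hD]
  have half : ∀ a : ℝ≥0∞, 1 ≤ 2 * (a + 1 / 2) := fun a => by
    rw [mul_add, one_div, ENNReal.mul_inv_cancel two_ne_zero ENNReal.ofNat_ne_top]
    exact le_add_self
  calc _ ≤ ∫⁻ h : Path d T, (∫⁻ x, (‖x‖ₑ + 1) *
          edelta (f ((splitLast d T).symm (h, x))) (g ((splitLast d T).symm (h, x)))) +
          edelta (marginalDensity f h) (marginalDensity g h) * (B + 1) := by
        refine lintegral_mono fun h => ?_
        have hcfh : Measurable (conditionalDensity f h) := hcf.of_uncurry_left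
        have hcgh : Measurable (conditionalDensity g h) := hcg.of_uncurry_left
        have hdh' := hdh h
        have hed := measurable_edelta hcfh hcgh
        rw [Pi.mul_apply, ← lintegral_const_mul _ (by fun_prop)]
        calc _ ≤ ∫⁻ x, ((‖x‖ₑ + 1) *
                edelta (f ((splitLast d T).symm (h, x))) (g ((splitLast d T).symm (h, x)))) +
                edelta (marginalDensity f h) (marginalDensity g h) *
                  ((‖x‖ₑ + 1) * conditionalDensity g h x) := by
              refine lintegral_mono fun x => ?_
              calc _ = (‖x‖ₑ + 1) * (marginalDensity f h *
                    edelta (conditionalDensity f h x) (conditionalDensity g h x)) := by ring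
                _ ≤ (‖x‖ₑ + 1) * (edelta (f ((splitLast d T).symm (h, x)))
                      (g ((splitLast d T).symm (h, x))) +
                      edelta (marginalDensity f h) (marginalDensity g h) *
                        conditionalDensity g h x) := by
                    gcongr
                    exact mul_edelta_div_le (hf0 h) (hft h) (hg0 h) (hgt h)
                _ = _ := by ring
          _ ≤ _ := by
              rw [lintegral_add_left (by fun_prop), lintegral_const_mul _ (by fun_prop)]
              gcongr
              exact lintegral_weight_conditionalDensity_le hg hg0 hgt hgB h
    _ = (∫⁻ h : Path d T, ∫⁻ x, (‖x‖ₑ + 1) *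
          edelta (f ((splitLast d T).symm (h, x))) (g ((splitLast d T).symm (h, x)))) +
        (∫⁻ h : Path d T, edelta (marginalDensity f h) (marginalDensity g h)) * (B + 1) := by
        rw [lintegral_add_right _ (by fun_prop), lintegral_mul_const _ hmd]
    -- The factors `2` adjust the weights: `‖x‖ + 1 ≤ 2 (‖h‖ + ‖x‖ + 1/2)` in the first term, `1 ≤ 2
    -- (‖h‖ + 1/2)` in the second.
    _ ≤ 2 * weightedDist f g + 2 * weightedDist (marginalDensity f) (marginalDensity g) * (B + 1) := by
        gcongr
        · unfold weightedDist
          rw [lintegral_path_succ (by fun_prop), ← lintegral_const_mul _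
            (Measurable.lintegral_prod_right' (f := fun p => (ENNReal.ofReal (pathNorm
              ((splitLast d T).symm p)) + 1 / 2) * edelta (f ((splitLast d T).symm p))
                (g ((splitLast d T).symm p))) (by
                  have := (splitLast d T).symm.measurable
                  have := hd.comp this
                  have : Measurable fun p => edelta (f ((splitLast d T).symm p))
                    (g ((splitLast d T).symm p)) := this
                  fun_prop))]
          refine lintegral_mono fun h => ?_
          simp only
          rw [← lintegral_const_mul _ (by
            have : Measurable fun x => pathNorm ((splitLast d T).symm (h, x)) :=
              hpn.comp ((splitLast d T).symm.measurable.comp (by fun_prop))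
            have := hdh h
            fun_prop)]
          refine lintegral_mono fun x => ?_
          simp only
          rw [← mul_assoc, pathNorm_splitLast_symm]
          gcongr
          rw [ENNReal.ofReal_add (pathNorm_nonneg _) (norm_nonneg _), ofReal_norm, mul_add, one_div,
            ENNReal.mul_inv_cancel two_ne_zero ENNReal.ofNat_ne_top]
          gcongr
          calc ‖x‖ₑ ≤ 1 * (ENNReal.ofReal (pathNorm h) + ‖x‖ₑ) := by rw [one_mul]; exact le_add_self
            _ ≤ _ := by gcongr; exact one_le_two
        · have := measurable_pathNorm (d := d) (T := T)
          unfold weightedDist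
          rw [← lintegral_const_mul _ (by fun_prop)]
          refine lintegral_mono fun h => ?_
          simp only
          rw [← mul_assoc]
          exact le_mul_of_one_le_left zero_le (half _)
    _ ≤ 2 * weightedDist f g + 2 * weightedDist f g * (B + 1) := by
        gcongr
        exact weightedDist_marginalDensity_le hf hg
    _ = _ := by ring

include hf hg hf0 hft hg0 hgt hf' hg' hfB hgB in
/-- A bicausal coupling of the marginals before the last time extends to a bicausal coupling whose
cost is controlled by the previous cost and the weighted distance of the densities. -/
theorem exists_bicausal_step (hf1 : ∫⁻ x, f x = 1) (hg1 : ∫⁻ x, g x = 1)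
    {π' : Measure (Path d T × Path d T)} [IsProbabilityMeasure π']
    (hπ' : IsBicausalCoupling (volume.withDensity (marginalDensity f))
      (volume.withDensity (marginalDensity g)) π') :
    ∃ π : Measure (Path d (T + 1) × Path d (T + 1)), IsProbabilityMeasure π ∧
      IsBicausalCoupling (volume.withDensity f) (volume.withDensity g) π ∧
      ∫⁻ z, pathCost z ∂π ≤ (1 + 2 * (B + 1)) * ∫⁻ z, pathCost z ∂π' +
        (2 + 2 * (B + 1)) * weightedDist f g := by
  have hcf := measurable_conditionalDensity hf
  have hcg := measurable_conditionalDensity hg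
  have hcf1 := lintegral_conditionalDensity hf hf0 hft
  have hcg1 := lintegral_conditionalDensity hg hg0 hgt
  have := isMarkovKernel_densityKernel (ρ := volume) hcf hcf1
  have := isMarkovKernel_densityKernel (ρ := volume) hcg hcg1
  obtain ⟨κ, hκ, hκc, hκd⟩ := exists_coupling_kernel (ρ := volume) hcf hcg
    (fun h x => ENNReal.div_ne_top (hf' _) (hf0 h)) (fun h x => ENNReal.div_ne_top (hg' _) (hg0 h))
    hcf1 hcg1
  have hprob : ∀ {k : Path d (T + 1) → ℝ≥0∞}, ∫⁻ x, k x = 1 →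
      IsProbabilityMeasure (volume.withDensity k) := fun hk => ⟨by simpa using hk⟩
  have hprob' : ∀ {k : Path d (T + 1) → ℝ≥0∞}, Measurable k → ∫⁻ x, k x = 1 →
      IsProbabilityMeasure (volume.withDensity (marginalDensity k)) := fun hkm hk => ⟨by
        rw [withDensity_apply _ MeasurableSet.univ, Measure.restrict_univ, ← hk,
          lintegral_path_succ hkm]
        rfl⟩
  have := hprob hf1
  have := hprob hg1
  have := hprob' hf hf1
  have := hprob' hg hg1
  have hjm := measurable_joinPair (d := d) (T := T)
  have hpc := measurable_pathCost (d := d) (T := T)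
  have hqc := measurable_pointCost (d := d)
  refine ⟨(π' ⊗ₘ κ).map joinPair, Measure.isProbabilityMeasure_map hjm.aemeasurable,
    hπ'.step (map_splitLast_withDensity hf hf0 hft) (map_splitLast_withDensity hg hg0 hgt) hκc, ?_⟩
  have hw : Measurable fun x : EuclideanSpace ℝ (Fin d) => ‖x‖ₑ + 1 := by fun_prop
  set D : Path d T → ℝ≥0∞ := fun h => ∫⁻ x, (‖x‖ₑ + 1) *
      edelta (conditionalDensity f h x) (conditionalDensity g h x) with hDdef
  have hD : Measurable D := by
    have := measurable_edelta hcf hcg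
    exact Measurable.lintegral_prod_right'
      (f := fun p : Path d T × EuclideanSpace ℝ (Fin d) => (‖p.2‖ₑ + 1) *
        edelta (conditionalDensity f p.1 p.2) (conditionalDensity g p.1 p.2))
      ((by fun_prop : Measurable fun p : Path d T × EuclideanSpace ℝ (Fin d) => ‖p.2‖ₑ + 1).mul this)
  have hstep : ∀ z : Path d T × Path d T, ∫⁻ q, pointCost q ∂(κ z) ≤
      2 * (B + 1) * pathCost z + D z.1 := by
    rintro ⟨h, h'⟩
    by_cases hh : h = h'
    · subst hh
      exact (hκd pointCost _ hqc hw pointCost_self pointCost_le h).trans le_add_self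
    -- Different pasts: the indicator in the previous cost is `1`, so the bounded cost `2 (B + 1)`
    -- of any coupling of the conditional laws can be charged to it.
    · have h1 : 1 ≤ pathCost (h, h') := by
        rw [pathCost, Set.indicator_of_mem (by simpa using hh)]
        exact le_add_self
      have hwf : ∫⁻ x, (‖x‖ₑ + 1) ∂(densityKernel volume (conditionalDensity f) h) ≤ B + 1 := by
        rw [lintegral_densityKernel hcf h hw]
        simp_rw [mul_comm (conditionalDensity f h _)]
        exact lintegral_weight_conditionalDensity_le hf hf0 hft hfB h
      have hwg : ∫⁻ x, (‖x‖ₑ + 1) ∂(densityKernel volume (conditionalDensity g) h') ≤ B + 1 := by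
        rw [lintegral_densityKernel hcg h' hw]
        simp_rw [mul_comm (conditionalDensity g h' _)]
        exact lintegral_weight_conditionalDensity_le hg hg0 hgt hgB h'
      calc ∫⁻ q, pointCost q ∂(κ (h, h'))
          ≤ ∫⁻ q, (‖q.1‖ₑ + 1) + (‖q.2‖ₑ + 1) ∂(κ (h, h')) :=
            lintegral_mono fun q => pointCost_le q.1 q.2
        _ = ∫⁻ x, (‖x‖ₑ + 1) ∂(densityKernel volume (conditionalDensity f) h) +
            ∫⁻ x, (‖x‖ₑ + 1) ∂(densityKernel volume (conditionalDensity g) h') := by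
            rw [lintegral_add_left (by fun_prop), ← (hκc (h, h')).1, ← (hκc (h, h')).2,
              lintegral_map hw measurable_fst, lintegral_map hw measurable_snd]
        _ ≤ (B + 1) + (B + 1) := add_le_add hwf hwg
        _ = 2 * (B + 1) * 1 := by ring
        _ ≤ 2 * (B + 1) * pathCost (h, h') + D h := by
            refine le_trans ?_ le_self_add
            gcongr
  -- `D` depends on the first past only, whose law under `π'` has density `marginalDensity f`.
  have hDμ : ∫⁻ z, D z.1 ∂π' ≤ (2 + 2 * (B + 1)) * weightedDist f g := by
    rw [← lintegral_map hD measurable_fst, hπ'.1.1]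
    exact lintegral_edelta_conditionalDensity_le hf hg hf0 hft hg0 hgt hgB
  calc ∫⁻ z, pathCost z ∂((π' ⊗ₘ κ).map joinPair)
      = ∫⁻ z, ∫⁻ q, pathCost (joinPair (z, q)) ∂(κ z) ∂π' := by
        rw [lintegral_map measurable_pathCost hjm,
          Measure.lintegral_compProd (f := fun q => pathCost (joinPair q))
            (measurable_pathCost.comp hjm)]
    _ ≤ ∫⁻ z, ∫⁻ q, pathCost z + pointCost q ∂(κ z) ∂π' :=
        lintegral_mono fun z => lintegral_mono fun q => pathCost_joinPair_le (z, q)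
    _ = ∫⁻ z, pathCost z + ∫⁻ q, pointCost q ∂(κ z) ∂π' := by
        refine lintegral_congr fun z => ?_
        rw [lintegral_add_left measurable_const]
        simp
    _ ≤ ∫⁻ z, pathCost z + (2 * (B + 1) * pathCost z + D z.1) ∂π' :=
        lintegral_mono fun z => add_le_add le_rfl (hstep z)
    _ = (1 + 2 * (B + 1)) * ∫⁻ z, pathCost z ∂π' + ∫⁻ z, D z.1 ∂π' := by
        rw [lintegral_add_left hpc, lintegral_add_left (by fun_prop), lintegral_const_mul _ hpc]
        ring
    _ ≤ _ := by gcongr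

end TwoDensities

end AdaptedWasserstein

/-! ### Gaussian densities, scaling and exponential moments -/

namespace AdaptedWasserstein

variable {d T : ℕ}

/-- This scaling reduces Gaussian integrals with parameter `σ` to `σ = 1`, so that the bounds become
uniform over `σ ≤ 1`. -/
theorem lintegral_eq_ofReal_mul_lintegral_smul {V : Type*} [NormedAddCommGroup V] [NormedSpace ℝ V]
    [FiniteDimensional ℝ V] [MeasurableSpace V] [BorelSpace V] (ρ : Measure V)
    [ρ.IsAddHaarMeasure] {s : ℝ} (hs : 0 < s) {F : V → ℝ≥0∞} (hF : Measurable F) :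
    ∫⁻ x, F x ∂ρ = ENNReal.ofReal (s ^ Module.finrank ℝ V) * ∫⁻ x, F (s • x) ∂ρ := by
  have hpos : 0 < s ^ Module.finrank ℝ V := pow_pos hs _
  rw [← lintegral_map hF (measurable_const_smul s), Measure.map_addHaar_smul ρ hs.ne',
    lintegral_smul_measure, abs_of_pos (inv_pos.2 hpos), smul_eq_mul, ← mul_assoc,
    ← ENNReal.ofReal_mul hpos.le, mul_inv_cancel₀ hpos.ne', ENNReal.ofReal_one, one_mul]

/-- The density of the Gaussian distribution `𝒩(0, σ² I_d)`. -/
noncomputable def pointGaussianDensity (d : ℕ) (σ : ℝ) (v : EuclideanSpace ℝ (Fin d)) : ℝ :=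
  (√((2 * Real.pi * σ ^ 2) ^ d))⁻¹ * Real.exp (-‖v‖ ^ 2 / (2 * σ ^ 2))

@[fun_prop]
theorem measurable_pointGaussianDensity {σ : ℝ} : Measurable (pointGaussianDensity d σ) := by
  unfold pointGaussianDensity; fun_prop

@[fun_prop]
theorem measurable_gaussianDensity {σ : ℝ} : Measurable (gaussianDensity (d := d) (T := T) σ) := by
  unfold gaussianDensity; fun_prop

theorem pointGaussianDensity_nonneg (σ : ℝ) (v : EuclideanSpace ℝ (Fin d)) :
    0 ≤ pointGaussianDensity d σ v := by
  unfold pointGaussianDensity; positivity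

theorem gaussianDensity_nonneg (σ : ℝ) (x : Path d T) : 0 ≤ gaussianDensity σ x := by
  unfold gaussianDensity; positivity

theorem gaussianDensity_pos {σ : ℝ} (hσ : 0 < σ) (x : Path d T) : 0 < gaussianDensity σ x := by
  unfold gaussianDensity; positivity

theorem gaussianDensity_le {σ : ℝ} (x : Path d T) :
    gaussianDensity σ x ≤ (√((2 * Real.pi * σ ^ 2) ^ (d * T)))⁻¹ := by
  unfold gaussianDensity
  refine mul_le_of_le_one_right (by positivity) (Real.exp_le_one_iff.2 ?_)
  exact div_nonpos_of_nonpos_of_nonneg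
    (neg_nonpos.2 (Finset.sum_nonneg fun _ _ => by positivity)) (by positivity)

theorem gaussianDensity_splitLast_symm (σ : ℝ) (p : Path d T × EuclideanSpace ℝ (Fin d)) :
    gaussianDensity σ ((splitLast d T).symm p) =
      gaussianDensity σ p.1 * pointGaussianDensity d σ p.2 := by
  have h1 : √((2 * Real.pi * σ ^ 2) ^ (d * (T + 1))) =
      √((2 * Real.pi * σ ^ 2) ^ (d * T)) * √((2 * Real.pi * σ ^ 2) ^ d) := by
    rw [← Real.sqrt_mul (by positivity), ← pow_add, mul_add, mul_one]
  simp only [gaussianDensity, pointGaussianDensity, Fin.sum_univ_castSucc, splitLast_symm_castSucc,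
    splitLast_symm_last]
  rw [h1, neg_add, add_div, Real.exp_add, mul_inv]
  ring

theorem splitLast_symm_sub (h : Path d T) (x : EuclideanSpace ℝ (Fin d)) (a : Path d (T + 1)) :
    (splitLast d T).symm (h, x) - a =
      (splitLast d T).symm (h - initPath a, x - a (Fin.last T)) := by
  funext t
  refine Fin.lastCases ?_ (fun s => ?_) t <;> simp [initPath]

/-- The known value of the integral is positive, while a nonintegrable function has integral `0` by
convention. -/
theorem integrable_exp_neg_mul_sq_norm {b : ℝ} (hb : 0 < b) :
    Integrable fun v : EuclideanSpace ℝ (Fin d) => Real.exp (-b * ‖v‖ ^ 2) := by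
  by_contra h
  have h1 := GaussianFourier.integral_rexp_neg_mul_sq_norm (V := EuclideanSpace ℝ (Fin d)) hb
  rw [integral_undef h] at h1
  have : 0 < (Real.pi / b) ^ (Module.finrank ℝ (EuclideanSpace ℝ (Fin d)) / 2 : ℝ) := by positivity
  exact this.ne h1

theorem lintegral_pointGaussianDensity {σ : ℝ} (hσ : 0 < σ) :
    ∫⁻ v, ENNReal.ofReal (pointGaussianDensity d σ v) = 1 := by
  have hb : 0 < 1 / (2 * σ ^ 2) := by positivity
  have hfun : ∀ v : EuclideanSpace ℝ (Fin d), Real.exp (-‖v‖ ^ 2 / (2 * σ ^ 2)) =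
      Real.exp (-(1 / (2 * σ ^ 2)) * ‖v‖ ^ 2) := fun v => by congr 1; ring
  rw [← ofReal_integral_eq_lintegral_ofReal _ (ae_of_all _ (pointGaussianDensity_nonneg σ))]
  · simp only [pointGaussianDensity, hfun]
    rw [integral_const_mul, GaussianFourier.integral_rexp_neg_mul_sq_norm hb,
      finrank_euclideanSpace_fin, div_div_eq_mul_div, div_one,
      show Real.pi * (2 * σ ^ 2) = 2 * Real.pi * σ ^ 2 by ring,
      Real.sqrt_eq_rpow, ← Real.rpow_natCast, ← Real.rpow_mul (by positivity),
      show ((d : ℝ) * (1 / 2)) = d / 2 by ring, inv_mul_cancel₀ (by positivity), ENNReal.ofReal_one]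
  · unfold pointGaussianDensity
    simp only [hfun]
    exact (integrable_exp_neg_mul_sq_norm hb).const_mul _

theorem lintegral_gaussianDensity {σ : ℝ} (hσ : 0 < σ) :
    ∀ T : ℕ, ∫⁻ x : Path d T, ENNReal.ofReal (gaussianDensity σ x) = 1
  | 0 => by
    have : ∀ x : Path d 0, ENNReal.ofReal (gaussianDensity σ x) = 1 := fun x => by
      simp [gaussianDensity]
    simp only [this, lintegral_one]
    rw [volume_pi, Measure.pi_of_empty (x := fun i => i.elim0)]
    simp
  | T + 1 => by
    rw [lintegral_path_succ (by fun_prop)]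
    simp only [gaussianDensity_splitLast_symm, ENNReal.ofReal_mul (gaussianDensity_nonneg _ _)]
    have : ∀ h : Path d T, ∫⁻ x, ENNReal.ofReal (gaussianDensity σ h) *
        ENNReal.ofReal (pointGaussianDensity d σ x) = ENNReal.ofReal (gaussianDensity σ h) :=
      fun h => by
        rw [lintegral_const_mul _ (by fun_prop), lintegral_pointGaussianDensity hσ, mul_one]
    simp only [this]
    exact lintegral_gaussianDensity hσ T

theorem pointGaussianDensity_smul {σ : ℝ} (hσ : 0 < σ) (v : EuclideanSpace ℝ (Fin d)) :
    σ ^ d * pointGaussianDensity d σ (σ • v) = pointGaussianDensity d 1 v := by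
  have h1 : √((2 * Real.pi * σ ^ 2) ^ d) = √((2 * Real.pi) ^ d) * σ ^ d := by
    rw [mul_pow, Real.sqrt_mul (by positivity), ← pow_mul, mul_comm 2 d, pow_mul,
      Real.sqrt_sq (by positivity)]
  have h2 : -‖σ • v‖ ^ 2 / (2 * σ ^ 2) = -‖v‖ ^ 2 / (2 * 1 ^ 2) := by
    rw [norm_smul, Real.norm_of_nonneg hσ.le]; field_simp
  unfold pointGaussianDensity
  rw [h1, h2]
  have : √((2 * Real.pi) ^ d) ≠ 0 := by positivity
  have := pow_pos hσ d
  simp only [one_pow, mul_one]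
  field_simp

theorem gaussianDensity_smul {σ : ℝ} (hσ : 0 < σ) (x : Path d T) :
    σ ^ (d * T) * gaussianDensity σ (σ • x) = gaussianDensity 1 x := by
  have h1 : √((2 * Real.pi * σ ^ 2) ^ (d * T)) = √((2 * Real.pi) ^ (d * T)) * σ ^ (d * T) := by
    rw [mul_pow, Real.sqrt_mul (by positivity),
      show (σ ^ 2) ^ (d * T) = (σ ^ (d * T)) ^ 2 by ring, Real.sqrt_sq (by positivity)]
  have h2 : -(∑ t, ‖(σ • x) t‖ ^ 2) / (2 * σ ^ 2) = -(∑ t, ‖x t‖ ^ 2) / (2 * 1 ^ 2) := by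
    have : ∀ t, ‖(σ • x) t‖ ^ 2 = σ ^ 2 * ‖x t‖ ^ 2 := fun t => by
      rw [Pi.smul_apply, norm_smul, Real.norm_of_nonneg hσ.le, mul_pow]
    simp only [this, ← Finset.mul_sum]
    field_simp
  unfold gaussianDensity
  rw [h1, h2]
  have : √((2 * Real.pi) ^ (d * T)) ≠ 0 := by positivity
  have := pow_pos hσ (d * T)
  simp only [one_pow, mul_one]
  field_simp

theorem finrank_path : Module.finrank ℝ (Path d T) = d * T := by
  simp [Module.finrank_pi_fintype, mul_comm]

theorem lintegral_mul_pointGaussianDensity {σ : ℝ} (hσ : 0 < σ)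
    {F : EuclideanSpace ℝ (Fin d) → ℝ≥0∞} (hF : Measurable F) :
    ∫⁻ v, F v * ENNReal.ofReal (pointGaussianDensity d σ v) =
      ∫⁻ v, F (σ • v) * ENNReal.ofReal (pointGaussianDensity d 1 v) := by
  rw [lintegral_eq_ofReal_mul_lintegral_smul volume hσ (by fun_prop),
    ← lintegral_const_mul _ (by fun_prop)]
  refine lintegral_congr fun v => ?_
  rw [← pointGaussianDensity_smul hσ, finrank_euclideanSpace_fin, ENNReal.ofReal_mul (by positivity)]
  ring

theorem lintegral_mul_gaussianDensity {σ : ℝ} (hσ : 0 < σ) {F : Path d T → ℝ≥0∞}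
    (hF : Measurable F) :
    ∫⁻ x, F x * ENNReal.ofReal (gaussianDensity σ x) =
      ∫⁻ x, F (σ • x) * ENNReal.ofReal (gaussianDensity 1 x) := by
  rw [lintegral_eq_ofReal_mul_lintegral_smul volume hσ (by fun_prop),
    ← lintegral_const_mul _ (by fun_prop)]
  refine lintegral_congr fun x => ?_
  rw [← gaussianDensity_smul hσ, finrank_path, ENNReal.ofReal_mul (by positivity)]
  ring

/-- The first absolute moment of the standard Gaussian distribution on `ℝ^d`. -/
noncomputable def pointGaussianMoment (d : ℕ) : ℝ≥0∞ :=
  ∫⁻ v, ‖v‖ₑ * ENNReal.ofReal (pointGaussianDensity d 1 v)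

theorem lintegral_exp_norm_mul_pointGaussianDensity_lt_top :
    ∫⁻ v, ENNReal.ofReal (Real.exp ‖v‖) * ENNReal.ofReal (pointGaussianDensity d 1 v) < ∞ := by
  have hint : Integrable fun v : EuclideanSpace ℝ (Fin d) =>
      ((√((2 * Real.pi * 1 ^ 2) ^ d))⁻¹ * Real.exp 1) * Real.exp (-(1 / 4 : ℝ) * ‖v‖ ^ 2) :=
    (integrable_exp_neg_mul_sq_norm (by norm_num)).const_mul _
  refine lt_of_le_of_lt (lintegral_mono fun v => ?_) hint.lintegral_lt_top
  rw [← ENNReal.ofReal_mul (by positivity)]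
  refine ENNReal.ofReal_le_ofReal ?_
  unfold pointGaussianDensity
  rw [mul_left_comm, ← Real.exp_add, mul_assoc _⁻¹ (Real.exp 1), ← Real.exp_add]
  refine mul_le_mul_of_nonneg_left (Real.exp_le_exp.2 ?_) (by positivity)
  -- With `r = ‖v‖`, the inequality `r - r²/2 ≤ 1 - r²/4` is `(r/2 - 1)² ≥ 0`.
  nlinarith [sq_nonneg (‖v‖ / 2 - 1)]

theorem pointGaussianMoment_lt_top : pointGaussianMoment d < ∞ := by
  refine lt_of_le_of_lt (lintegral_mono fun v => ?_)
    (lintegral_exp_norm_mul_pointGaussianDensity_lt_top (d := d))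
  gcongr
  rw [← ofReal_norm]
  refine ENNReal.ofReal_le_ofReal ?_
  linarith [Real.add_one_le_exp ‖v‖]

theorem lintegral_enorm_mul_pointGaussianDensity_le {σ : ℝ} (hσ : 0 < σ) (hσ1 : σ ≤ 1) :
    ∫⁻ v, ‖v‖ₑ * ENNReal.ofReal (pointGaussianDensity d σ v) ≤ pointGaussianMoment d := by
  rw [lintegral_mul_pointGaussianDensity hσ (by fun_prop)]
  refine lintegral_mono fun v => ?_
  gcongr
  rw [← ofReal_norm, ← ofReal_norm, norm_smul, Real.norm_of_nonneg hσ.le]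
  exact ENNReal.ofReal_le_ofReal (mul_le_of_le_one_left (norm_nonneg _) hσ1)

/-- The exponential of the sum-norm factors over time, unlike its powers, so induction on `T`
applies; the polynomial moments follow by domination. -/
theorem lintegral_exp_pathNorm_mul_gaussianDensity_lt_top : ∀ T : ℕ,
    ∫⁻ x : Path d T, ENNReal.ofReal (Real.exp (pathNorm x)) *
      ENNReal.ofReal (gaussianDensity 1 x) < ∞
  | 0 => by
    have : ∀ x : Path d 0, ENNReal.ofReal (Real.exp (pathNorm x)) *
        ENNReal.ofReal (gaussianDensity 1 x) = ENNReal.ofReal (gaussianDensity 1 x) := fun x => by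
      simp [pathNorm]
    simp only [this, lintegral_gaussianDensity one_pos 0]
    exact ENNReal.one_lt_top
  | T + 1 => by
    have := measurable_pathNorm (d := d) (T := T + 1)
    have hT := measurable_pathNorm (d := d) (T := T)
    rw [lintegral_path_succ (by fun_prop)]
    simp only [gaussianDensity_splitLast_symm, ENNReal.ofReal_mul (gaussianDensity_nonneg _ _),
      pathNorm_splitLast_symm, Real.exp_add, ENNReal.ofReal_mul (Real.exp_nonneg _)]
    have : ∀ h : Path d T, ∫⁻ x : EuclideanSpace ℝ (Fin d), ENNReal.ofReal (Real.exp (pathNorm h)) *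
        ENNReal.ofReal (Real.exp ‖x‖) * (ENNReal.ofReal (gaussianDensity 1 h) *
        ENNReal.ofReal (pointGaussianDensity d 1 x)) = ENNReal.ofReal (Real.exp (pathNorm h)) *
          ENNReal.ofReal (gaussianDensity 1 h) *
          ∫⁻ v, ENNReal.ofReal (Real.exp ‖v‖) * ENNReal.ofReal (pointGaussianDensity d 1 v) :=
      fun h => by
        rw [← lintegral_const_mul _ (by fun_prop)]
        refine lintegral_congr fun x => ?_
        ring
    simp only [this]
    rw [lintegral_mul_const _ (by fun_prop)]
    exact ENNReal.mul_lt_top (lintegral_exp_pathNorm_mul_gaussianDensity_lt_top T)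
      lintegral_exp_norm_mul_pointGaussianDensity_lt_top

/-- The density of `μ ∗ 𝒩_σ`. -/
noncomputable def mixtureDensity (σ : ℝ) (μ : Measure (Path d T)) (x : Path d T) : ℝ≥0∞ :=
  ∫⁻ a, ENNReal.ofReal (gaussianDensity σ (x - a)) ∂μ

/-! ### Gaussian mixtures, their marginals and conditional laws -/

section Mixture

variable {σ : ℝ}

theorem measurable_mixtureDensity (μ : Measure (Path d T)) [SFinite μ] :
    Measurable (mixtureDensity σ μ) :=
  Measurable.lintegral_prod_right' (f := fun p : Path d T × Path d T =>
    ENNReal.ofReal (gaussianDensity σ (p.1 - p.2))) (by fun_prop)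

theorem mixtureDensity_ne_zero (hσ : 0 < σ) (μ : Measure (Path d T)) [IsProbabilityMeasure μ]
    (x : Path d T) : mixtureDensity σ μ x ≠ 0 := by
  intro h
  rw [mixtureDensity, lintegral_eq_zero_iff (by fun_prop)] at h
  obtain ⟨a, ha⟩ := h.exists
  exact (ENNReal.ofReal_pos.2 (gaussianDensity_pos hσ (x - a))).ne' ha

theorem mixtureDensity_ne_top (μ : Measure (Path d T)) [IsProbabilityMeasure μ] (x : Path d T) :
    mixtureDensity σ μ x ≠ ∞ := by
  refine ((lintegral_mono fun a => ENNReal.ofReal_le_ofReal (gaussianDensity_le (x - a))).trans_lt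
    ?_).ne
  simp

theorem lintegral_mul_mixtureDensity (μ : Measure (Path d T)) [SFinite μ] {F : Path d T → ℝ≥0∞}
    (hF : Measurable F) :
    ∫⁻ x, F x * mixtureDensity σ μ x =
      ∫⁻ a, ∫⁻ x, F (x + a) * ENNReal.ofReal (gaussianDensity σ x) ∂volume ∂μ := by
  unfold mixtureDensity
  have : ∀ x, F x * ∫⁻ a, ENNReal.ofReal (gaussianDensity σ (x - a)) ∂μ =
      ∫⁻ a, F x * ENNReal.ofReal (gaussianDensity σ (x - a)) ∂μ := fun x => by
    rw [lintegral_const_mul _ (by fun_prop)]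
  simp only [this]
  rw [lintegral_lintegral_swap (by fun_prop)]
  refine lintegral_congr fun a => ?_
  rw [← lintegral_add_right_eq_self _ a]
  simp

theorem conv_gaussian (μ : Measure (Path d T)) [SFinite μ] :
    μ.conv (gaussian d T σ) = volume.withDensity (mixtureDensity σ μ) := by
  refine Measure.ext_of_lintegral _ fun F hF => ?_
  have hm := measurable_mixtureDensity (σ := σ) μ
  rw [gaussian, Measure.lintegral_conv hF, lintegral_withDensity_eq_lintegral_mul _ hm hF]
  simp only [Pi.mul_apply]
  simp_rw [mul_comm (mixtureDensity σ μ _)]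
  rw [lintegral_mul_mixtureDensity μ hF]
  refine lintegral_congr fun a => ?_
  rw [lintegral_withDensity_eq_lintegral_mul _ (by fun_prop) (by fun_prop)]
  refine lintegral_congr fun x => ?_
  simp only [Pi.mul_apply]
  rw [mul_comm, add_comm]

theorem lintegral_mixtureDensity (hσ : 0 < σ) (μ : Measure (Path d T)) [IsProbabilityMeasure μ] :
    ∫⁻ x, mixtureDensity σ μ x = 1 := by
  have := lintegral_mul_mixtureDensity (σ := σ) μ (F := 1) measurable_one
  simpa [lintegral_gaussianDensity hσ T] using this

theorem mixtureDensity_splitLast_symm (μ : Measure (Path d (T + 1))) (h : Path d T)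
    (x : EuclideanSpace ℝ (Fin d)) : mixtureDensity σ μ ((splitLast d T).symm (h, x)) =
      ∫⁻ a, ENNReal.ofReal (gaussianDensity σ (h - initPath a)) *
        ENNReal.ofReal (pointGaussianDensity d σ (x - a (Fin.last T))) ∂μ := by
  unfold mixtureDensity
  refine lintegral_congr fun a => ?_
  rw [splitLast_symm_sub, gaussianDensity_splitLast_symm,
    ENNReal.ofReal_mul (gaussianDensity_nonneg _ _)]

theorem lintegral_mul_mixtureDensity_splitLast_symm (μ : Measure (Path d (T + 1))) [SFinite μ]
    (h : Path d T) {F : EuclideanSpace ℝ (Fin d) → ℝ≥0∞} (hF : Measurable F) :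
    ∫⁻ x, F x * mixtureDensity σ μ ((splitLast d T).symm (h, x)) =
      ∫⁻ a, ENNReal.ofReal (gaussianDensity σ (h - initPath a)) *
        ∫⁻ x, F (x + a (Fin.last T)) * ENNReal.ofReal (pointGaussianDensity d σ x) ∂volume ∂μ := by
  have := measurable_initPath (d := d) (T := T)
  have h1 : ∀ x, F x * mixtureDensity σ μ ((splitLast d T).symm (h, x)) =
      ∫⁻ a, F x * (ENNReal.ofReal (gaussianDensity σ (h - initPath a)) *
        ENNReal.ofReal (pointGaussianDensity d σ (x - a (Fin.last T)))) ∂μ := fun x => by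
    rw [mixtureDensity_splitLast_symm, lintegral_const_mul _ (by fun_prop)]
  simp only [h1]
  rw [lintegral_lintegral_swap (by fun_prop)]
  refine lintegral_congr fun a => ?_
  rw [← lintegral_const_mul _ (by fun_prop), ← lintegral_add_right_eq_self _ (a (Fin.last T))]
  refine lintegral_congr fun x => ?_
  rw [add_sub_cancel_right]
  ring

/-- The Gaussian factor of the last time integrates to one. Mixtures are thus stable under
forgetting the last point, which lets the induction on `T` close. -/
theorem marginalDensity_mixtureDensity (hσ : 0 < σ) (μ : Measure (Path d (T + 1))) [SFinite μ] :
    marginalDensity (mixtureDensity σ μ) = mixtureDensity σ (μ.map initPath) := by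
  funext h
  have := lintegral_mul_mixtureDensity_splitLast_symm (σ := σ) μ h (F := 1) measurable_one
  simp only [Pi.one_apply, one_mul, lintegral_pointGaussianDensity hσ, mul_one] at this
  rw [marginalDensity, this, mixtureDensity, lintegral_map (by fun_prop) measurable_initPath]

/-- Given any past `h`, the last point is a centre `a (Fin.last T)`, drawn with weight proportional
to `gaussianDensity σ (h - initPath a)`, plus independent Gaussian noise. Centres have norm at most
`R`, whence a bound uniform in `h`. -/
theorem lintegral_enorm_mul_conditionalDensity_mixtureDensity_le (hσ : 0 < σ) {R b : ℝ≥0∞}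
    (hb : ∫⁻ v, ‖v‖ₑ * ENNReal.ofReal (pointGaussianDensity d σ v) ≤ b)
    (μ : Measure (Path d (T + 1))) [IsProbabilityMeasure μ] (hμ : ∀ᵐ a ∂μ, ∀ t, ‖a t‖ₑ ≤ R)
    (h : Path d T) : ∫⁻ x, ‖x‖ₑ * conditionalDensity (mixtureDensity σ μ) h x ≤ b + R := by
  have hi := measurable_initPath (d := d) (T := T)
  have : IsProbabilityMeasure (μ.map initPath) :=
    Measure.isProbabilityMeasure_map measurable_initPath.aemeasurable
  have hm : Measurable fun x => mixtureDensity σ μ ((splitLast d T).symm (h, x)) :=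
    (measurable_mixtureDensity μ).comp ((splitLast d T).symm.measurable.comp (by fun_prop))
  simp only [conditionalDensity, marginalDensity_mixtureDensity hσ, div_eq_mul_inv, ← mul_assoc]
  rw [lintegral_mul_const _ (by fun_prop), ← div_eq_mul_inv]
  refine ENNReal.div_le_of_le_mul ?_
  rw [lintegral_mul_mixtureDensity_splitLast_symm μ h (by fun_prop)]
  calc _ ≤ ∫⁻ a, ENNReal.ofReal (gaussianDensity σ (h - initPath a)) * (b + R) ∂μ := by
        refine lintegral_mono_ae ?_
        filter_upwards [hμ] with a ha
        gcongr
        calc _ ≤ ∫⁻ x, ‖x‖ₑ * ENNReal.ofReal (pointGaussianDensity d σ x) +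
              R * ENNReal.ofReal (pointGaussianDensity d σ x) := by
              refine lintegral_mono fun x => ?_
              rw [← add_mul]
              gcongr
              exact (enorm_add_le _ _).trans (add_le_add le_rfl (ha _))
          _ ≤ b + R := by
              rw [lintegral_add_left (by fun_prop), lintegral_const_mul _ (by fun_prop),
                lintegral_pointGaussianDensity hσ, mul_one]
              gcongr
    _ = _ := by
        rw [lintegral_mul_const _ (by fun_prop), mul_comm, mixtureDensity,
          lintegral_map (by fun_prop) measurable_initPath]

end Mixture

theorem isProbabilityMeasure_withDensity_mixtureDensity {σ : ℝ} (hσ : 0 < σ)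
    (μ : Measure (Path d T)) [IsProbabilityMeasure μ] :
    IsProbabilityMeasure (volume.withDensity (mixtureDensity σ μ)) :=
  ⟨by simpa using lintegral_mixtureDensity hσ μ⟩

/-- For distributions with uniformly bounded support, smoothed by a Gaussian kernel, there is a
bicausal coupling whose cost is controlled by a weighted total variation distance. -/
theorem exists_bicausalCoupling_mixtureDensity (d : ℕ) (R b : ℝ≥0) : ∀ T : ℕ, ∃ A : ℝ≥0,
    ∀ σ : ℝ, 0 < σ → (∫⁻ v, ‖v‖ₑ * ENNReal.ofReal (pointGaussianDensity d σ v) ≤ b) →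
    ∀ μ ν : Measure (Path d T), IsProbabilityMeasure μ → IsProbabilityMeasure ν →
    (∀ᵐ a ∂μ, ∀ t, ‖a t‖ₑ ≤ R) → (∀ᵐ a ∂ν, ∀ t, ‖a t‖ₑ ≤ R) →
    ∃ π, IsProbabilityMeasure π ∧ IsBicausalCoupling (volume.withDensity (mixtureDensity σ μ))
        (volume.withDensity (mixtureDensity σ ν)) π ∧
      ∫⁻ z, pathCost z ∂π ≤ A * weightedDist (mixtureDensity σ μ) (mixtureDensity σ ν)
  | 0 => ⟨0, fun σ hσ _ μ ν _ _ _ _ => by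
      have := isProbabilityMeasure_withDensity_mixtureDensity hσ μ
      have := isProbabilityMeasure_withDensity_mixtureDensity hσ ν
      refine ⟨(volume.withDensity (mixtureDensity σ μ)).prod
        (volume.withDensity (mixtureDensity σ ν)), inferInstance,
        ⟨⟨by simp, by simp⟩, fun t => t.elim0⟩, ?_⟩
      have h0 : ∀ z : Path d 0 × Path d 0, pathCost z = 0 := fun z => by
        have : z.1 = z.2 := Subsingleton.elim _ _
        simp [pathCost, pathNorm, this]
      simp [h0]⟩
  | T + 1 => by
    obtain ⟨A, hA⟩ := exists_bicausalCoupling_mixtureDensity d R b T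
    -- The recursion of `exists_bicausal_step` with `B = b + R`, after the distance of the marginals
    -- is bounded by that of the joint densities.
    refine ⟨(1 + 2 * (b + R + 1)) * A + (2 + 2 * (b + R + 1)), fun σ hσ hb μ ν _ _ hμ hν => ?_⟩
    have hprob : ∀ (m : Measure (Path d (T + 1))) [IsProbabilityMeasure m],
        IsProbabilityMeasure (m.map initPath) := fun m _ =>
      Measure.isProbabilityMeasure_map measurable_initPath.aemeasurable
    have hsupp : ∀ {m : Measure (Path d (T + 1))}, (∀ᵐ a ∂m, ∀ t, ‖a t‖ₑ ≤ R) →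
        ∀ᵐ a ∂(m.map initPath), ∀ t, ‖a t‖ₑ ≤ R := fun {m} hm => by
      rw [ae_map_iff measurable_initPath.aemeasurable (by
        simp only [Set.ofPred_forall]
        exact MeasurableSet.iInter fun t => measurableSet_le (by fun_prop) measurable_const)]
      filter_upwards [hm] with a ha t using ha _
    have := hprob μ
    have := hprob ν
    obtain ⟨π', hπ'p, hπ', hπ'c⟩ := hA σ hσ hb (μ.map initPath) (ν.map initPath) inferInstance
      inferInstance (hsupp hμ) (hsupp hν)
    have hmμ := marginalDensity_mixtureDensity hσ μ
    have hmν := marginalDensity_mixtureDensity hσ ν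
    rw [← hmμ, ← hmν] at hπ' hπ'c
    obtain ⟨π, hπp, hπ, hπc⟩ := exists_bicausal_step (measurable_mixtureDensity μ)
      (measurable_mixtureDensity ν)
      (fun h => by rw [hmμ]; exact mixtureDensity_ne_zero hσ _ _)
      (fun h => by rw [hmμ]; exact mixtureDensity_ne_top _ _)
      (fun h => by rw [hmν]; exact mixtureDensity_ne_zero hσ _ _)
      (fun h => by rw [hmν]; exact mixtureDensity_ne_top _ _)
      (mixtureDensity_ne_top μ) (mixtureDensity_ne_top ν)
      (lintegral_enorm_mul_conditionalDensity_mixtureDensity_le hσ hb μ hμ)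
      (lintegral_enorm_mul_conditionalDensity_mixtureDensity_le hσ hb ν hν)
      (lintegral_mixtureDensity hσ μ) (lintegral_mixtureDensity hσ ν) hπ'
    refine ⟨π, hπp, hπ, hπc.trans ?_⟩
    push_cast
    calc _ ≤ (1 + 2 * ((b : ℝ≥0∞) + R + 1)) *
          (A * weightedDist (mixtureDensity σ μ) (mixtureDensity σ ν)) +
          (2 + 2 * ((b : ℝ≥0∞) + R + 1)) *
            weightedDist (mixtureDensity σ μ) (mixtureDensity σ ν) := by
          gcongr
          refine hπ'c.trans ?_
          gcongr
          exact weightedDist_marginalDensity_le (measurable_mixtureDensity μ)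
            (measurable_mixtureDensity ν)
      _ = _ := by ring

/-- The smoothed adapted Wasserstein distance is controlled by a weighted total variation distance,
uniformly over distributions with a common bounded support. -/
theorem exists_smoothedAdaptedWasserstein_le (d T : ℕ) (R : ℝ≥0) : ∃ A : ℝ≥0,
    ∀ σ : ℝ, 0 < σ → σ ≤ 1 →
    ∀ μ ν : Measure (Path d T), IsProbabilityMeasure μ → IsProbabilityMeasure ν →
    (∀ᵐ a ∂μ, ∀ t, ‖a t‖ₑ ≤ R) → (∀ᵐ a ∂ν, ∀ t, ‖a t‖ₑ ≤ R) →
    smoothedAdaptedWasserstein σ μ ν ≤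
      A * weightedDist (mixtureDensity σ μ) (mixtureDensity σ ν) := by
  obtain ⟨A, hA⟩ := exists_bicausalCoupling_mixtureDensity d R (pointGaussianMoment d).toNNReal T
  refine ⟨A, fun σ hσ hσ1 μ ν _ _ hμ hν => ?_⟩
  obtain ⟨π, -, hπ, hπc⟩ := hA σ hσ (by
    rw [ENNReal.coe_toNNReal pointGaussianMoment_lt_top.ne]
    exact lintegral_enorm_mul_pointGaussianDensity_le hσ hσ1) μ ν inferInstance inferInstance hμ hν
  rw [smoothedAdaptedWasserstein, conv_gaussian, conv_gaussian]
  refine (iInf₂_le π hπ).trans (le_trans (lintegral_mono fun z => ?_) hπc)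
  exact le_self_add

end AdaptedWasserstein

namespace AdaptedWasserstein

/-! ### Sub-Gaussian concentration under bounded differences -/

section BoundedDifferences

variable {α : Type*} [MeasurableSpace α] {μ : Measure α} [IsProbabilityMeasure μ]

/-- Hoeffding's lemma on the interval of radius `c` around a single value `Y a₀`; its half-length
`c` gives the parameter `c ^ 2`. -/
theorem hasSubgaussianMGF_of_abs_sub_le {Y : α → ℝ} (hY : Measurable Y) {c : ℝ≥0}
    (hc : ∀ a b, |Y a - Y b| ≤ c) : HasSubgaussianMGF (fun a => Y a - ∫ b, Y b ∂μ) (c ^ 2) μ := by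
  obtain ⟨a₀⟩ : Nonempty α := nonempty_of_isProbabilityMeasure μ
  have h := hasSubgaussianMGF_of_mem_Icc (μ := μ) (a := Y a₀ - c) (b := Y a₀ + c) hY.aemeasurable
    (ae_of_all _ fun a => ⟨by linarith [(abs_le.1 (hc a a₀)).1], by linarith [(abs_le.1 (hc a a₀)).2]⟩)
  convert h using 2
  ext
  simp [show (Y a₀ + c - (Y a₀ - c) : ℝ) = 2 * c by ring]

/-- **McDiarmid's inequality**, in the form of a bound on the moment generating function (with a
constant that is not optimal). -/
theorem hasSubgaussianMGF_of_bounded_differences {c : ℝ≥0} {C : ℝ} : ∀ {N : ℕ}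
    {F : (Fin N → α) → ℝ}, Measurable F → (∀ x, |F x| ≤ C) →
    (∀ x i a, |F (Function.update x i a) - F x| ≤ c) →
    HasSubgaussianMGF (fun x => F x - ∫ y, F y ∂(Measure.pi fun _ => μ)) (N * c ^ 2)
      (Measure.pi fun _ => μ)
  | 0, F, _, _, _ => by
    have h : (fun x => F x - ∫ y, F y ∂(Measure.pi fun _ : Fin 0 => μ)) = fun _ => 0 := by
      funext x
      have : ∀ y, F y = F x := fun y => congrArg F (Subsingleton.elim _ _)
      simp [this]
    rw [h]
    simp
  | N + 1, F, hF, hC, hc => by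
    have hmp := (measurePreserving_piFinSuccAbove (fun _ : Fin (N + 1) => μ) 0).symm
    have he : ∀ p : α × (Fin N → α),
        (MeasurableEquiv.piFinSuccAbove (fun _ : Fin (N + 1) => α) 0).symm p = Fin.cons p.1 p.2 :=
      fun p => by
        simp [MeasurableEquiv.piFinSuccAbove_symm_apply, Fin.insertNthEquiv]
    have hcons : Measurable fun p : α × (Fin N → α) => (Fin.cons p.1 p.2 : Fin (N + 1) → α) := by
      have := (MeasurableEquiv.piFinSuccAbove (fun _ : Fin (N + 1) => α) 0).symm.measurable
      convert this using 2 with p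
      exact (he p).symm
    have hint : ∀ H : (Fin (N + 1) → α) → ℝ, ∫ x, H x ∂(Measure.pi fun _ => μ) =
        ∫ p : α × (Fin N → α), H (Fin.cons p.1 p.2) ∂(μ.prod (Measure.pi fun _ => μ)) := fun H => by
      rw [← hmp.integral_comp']
      simp only [he]
    have hbint : ∀ {β : Type _} [MeasurableSpace β] (ρ : Measure β) [IsProbabilityMeasure ρ]
        {H : β → ℝ} {D : ℝ}, Measurable H → (∀ x, |H x| ≤ D) → Integrable H ρ :=
      fun ρ _ _ D hH hD => Integrable.of_bound hH.aestronglyMeasurable D (ae_of_all _ hD)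
    -- Averaging over the first coordinate preserves the bounded differences and the mean. In `F - m
    -- = (F - G) + (G - m)` the first term is sub-Gaussian with parameter `c ^ 2` for fixed
    -- remaining coordinates, the second by induction.
    set G : (Fin N → α) → ℝ := fun x => ∫ a, F (Fin.cons a x) ∂μ with hG
    have hFc : Measurable fun p : α × (Fin N → α) => F (Fin.cons p.1 p.2) := hF.comp hcons
    have hFx : ∀ x : Fin N → α, Measurable fun a => F (Fin.cons a x) := fun x =>
      hFc.comp (measurable_id.prodMk measurable_const)
    have hGm : Measurable G :=
      (hFc.stronglyMeasurable.integral_prod_left').measurable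
    have hGC : ∀ x, |G x| ≤ C := fun x => by
      have := norm_integral_le_of_norm_le_const (μ := μ) (f := fun a => F (Fin.cons a x))
        (ae_of_all _ fun a => hC _)
      simpa using this
    have hGc : ∀ x i b, |G (Function.update x i b) - G x| ≤ c := fun x i b => by
      simp only [hG]
      rw [← integral_sub (hbint μ (hFx _) fun a => hC _) (hbint μ (hFx _) fun a => hC _)]
      have := norm_integral_le_of_norm_le_const (μ := μ) (C := c)
        (f := fun a => F (Fin.cons a (Function.update x i b)) - F (Fin.cons a x))
        (ae_of_all _ fun a => by
          rw [Fin.cons_update]; exact hc _ _ _)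
      simpa using this
    have hEF : ∫ x, F x ∂(Measure.pi fun _ => μ) = ∫ x, G x ∂(Measure.pi fun _ => μ) := by
      rw [hint, integral_prod_symm _ (hbint _ hFc fun p => hC _)]
    have ih := hasSubgaussianMGF_of_bounded_differences (N := N) hGm hGC hGc
    rw [hEF]
    set m := ∫ x, G x ∂(Measure.pi fun _ => μ) with hm
    have hexp_le : ∀ (t y D : ℝ), |y| ≤ D → |Real.exp (t * y)| ≤ Real.exp (|t| * D) := fun t y D h => by
      rw [abs_of_pos (Real.exp_pos _)]
      refine Real.exp_le_exp.2 ((le_abs_self _).trans ?_)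
      rw [abs_mul]; gcongr
    have hFm : ∀ x, |F x - m| ≤ C + |m| := fun x => (abs_sub _ _).trans (by linarith [hC x])
    refine ⟨fun t => hbint _ (D := Real.exp (|t| * (C + |m|))) (by fun_prop)
      fun x => hexp_le _ _ _ (hFm x), fun t => ?_⟩
    have hY : ∀ x : Fin N → α, ∫ a, Real.exp (t * (F (Fin.cons a x) - G x)) ∂μ ≤
        Real.exp (c ^ 2 * t ^ 2 / 2) := fun x => by
      have := (hasSubgaussianMGF_of_abs_sub_le (μ := μ) (hFx x) (c := c) (fun a b => by
        have := hc (Fin.cons b x) 0 a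
        rwa [Fin.update_cons_zero] at this)).mgf_le t
      simpa [mgf] using this
    rw [mgf, hint, integral_prod_symm _ (hbint _ (D := Real.exp (|t| * (C + |m|))) (by fun_prop)
      fun p => hexp_le _ _ _ (hFm _))]
    calc _ = ∫ x, (∫ a, Real.exp (t * (F (Fin.cons a x) - G x)) ∂μ) * Real.exp (t * (G x - m))
          ∂(Measure.pi fun _ => μ) := by
          refine integral_congr_ae (ae_of_all _ fun x => ?_)
          simp only
          rw [← integral_mul_const]
          refine integral_congr_ae (ae_of_all _ fun a => ?_)
          simp only
          rw [← Real.exp_add]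
          congr 1; ring
      _ ≤ ∫ x, Real.exp (c ^ 2 * t ^ 2 / 2) * Real.exp (t * (G x - m))
          ∂(Measure.pi fun _ => μ) := by
          refine integral_mono_of_nonneg (ae_of_all _ fun x => ?_)
            ((ih.integrable_exp_mul t).const_mul _) (ae_of_all _ fun x => ?_)
          · exact mul_nonneg (integral_nonneg fun a => (Real.exp_pos _).le) (Real.exp_pos _).le
          · exact mul_le_mul_of_nonneg_right (hY x) (Real.exp_pos _).le
      _ ≤ Real.exp (c ^ 2 * t ^ 2 / 2) * Real.exp (N * c ^ 2 * t ^ 2 / 2) := by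
          rw [integral_const_mul]
          have := ih.mgf_le t
          rw [mgf] at this
          gcongr
          simpa using this
      _ = _ := by
          rw [← Real.exp_add]
          push_cast
          congr 1; ring

end BoundedDifferences

end AdaptedWasserstein

namespace AdaptedWasserstein

variable {d T : ℕ}

/-! ### Moment bounds and integrability of the weight -/

section Moments

/-- The `p`-th absolute moment of the standard Gaussian distribution on the path space. -/
noncomputable def gaussianMoment (d T : ℕ) (p : ℝ) : ℝ≥0∞ :=
  ∫⁻ x : Path d T, ENNReal.ofReal (pathNorm x ^ p) * ENNReal.ofReal (gaussianDensity 1 x)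

/-- Raise `s / p ≤ exp (s / p)` to the power `p`. -/
theorem rpow_le_mul_exp {p s : ℝ} (hp : 0 < p) (hs : 0 ≤ s) : s ^ p ≤ p ^ p * Real.exp s := by
  have h1 : s ≤ p * Real.exp (s / p) := by
    have := Real.add_one_le_exp (s / p)
    calc s = p * (s / p) := by field_simp
      _ ≤ _ := by gcongr; linarith
  calc s ^ p ≤ (p * Real.exp (s / p)) ^ p := Real.rpow_le_rpow hs h1 hp.le
    _ = p ^ p * Real.exp s := by
      rw [Real.mul_rpow hp.le (Real.exp_pos _).le, ← Real.exp_mul]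
      congr 2; field_simp

theorem gaussianMoment_lt_top {p : ℝ} (hp : 0 < p) : gaussianMoment d T p < ∞ := by
  have := measurable_pathNorm (d := d) (T := T)
  have h : ∀ x : Path d T, ENNReal.ofReal (pathNorm x ^ p) * ENNReal.ofReal (gaussianDensity 1 x) ≤
      ENNReal.ofReal (p ^ p) * (ENNReal.ofReal (Real.exp (pathNorm x)) *
        ENNReal.ofReal (gaussianDensity 1 x)) := fun x => by
    have := pathNorm_nonneg x
    rw [← mul_assoc]
    gcongr
    rw [← ENNReal.ofReal_mul (by positivity)]
    refine ENNReal.ofReal_le_ofReal ?_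
    exact rpow_le_mul_exp hp (pathNorm_nonneg x)
  refine (lintegral_mono h).trans_lt ?_
  rw [lintegral_const_mul _ (by fun_prop)]
  exact ENNReal.mul_lt_top ENNReal.ofReal_lt_top (lintegral_exp_pathNorm_mul_gaussianDensity_lt_top T)

theorem pathNorm_add_le (x y : Path d T) : pathNorm (x + y) ≤ pathNorm x + pathNorm y := by
  unfold pathNorm
  rw [← Finset.sum_add_distrib]
  exact Finset.sum_le_sum fun t _ => norm_add_le _ _

theorem pathNorm_smul {s : ℝ} (hs : 0 ≤ s) (x : Path d T) : pathNorm (s • x) = s * pathNorm x := by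
  simp [pathNorm, norm_smul, Finset.mul_sum, abs_of_nonneg hs]

theorem norm_le_pathNorm (x : Path d T) : ‖x‖ ≤ pathNorm x :=
  (pi_norm_le_iff_of_nonneg (pathNorm_nonneg x)).2 fun t =>
    Finset.single_le_sum (f := fun t => ‖x t‖) (fun _ _ => norm_nonneg _) (Finset.mem_univ t)

theorem add_rpow_le_two_rpow_mul {p s t : ℝ} (hp : 0 ≤ p) (hs : 0 ≤ s) (ht : 0 ≤ t) :
    (s + t) ^ p ≤ 2 ^ p * (s ^ p + t ^ p) := by
  have hm : 0 ≤ max s t := le_max_of_le_left hs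
  calc (s + t) ^ p ≤ (2 * max s t) ^ p :=
        Real.rpow_le_rpow (by positivity) (by linarith [le_max_left s t, le_max_right s t]) hp
    _ = 2 ^ p * max s t ^ p := Real.mul_rpow (by norm_num) hm
    _ ≤ _ := by
      gcongr
      rcases le_total s t with h | h
      · rw [max_eq_right h]; linarith [Real.rpow_nonneg hs p]
      · rw [max_eq_left h]; linarith [Real.rpow_nonneg ht p]

/-- Since `(1 + ‖x‖)^p ≤ 2^p (1 + ‖x‖^p)`, the integrand is at most a constant times `(1 + ‖x‖)^(2 -
p)`, and `p - 2` exceeds the dimension. The exponent being negative, the sum-norm may be replaced by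
the smaller sup-norm. -/
theorem integrable_weight {p : ℝ} (hp : (d * T + 2 : ℝ) < p) :
    Integrable fun x : Path d T => (pathNorm x + 1 / 2) ^ 2 / (1 + pathNorm x ^ p) := by
  have hm := measurable_pathNorm (d := d) (T := T)
  have hp0 : 0 ≤ p := by have : (0 : ℝ) ≤ d * T := by positivity
                         linarith
  have hint : Integrable fun x : Path d T => 2 ^ p * (1 + ‖x‖) ^ (-(p - 2)) :=
    (integrable_one_add_norm (by rw [finrank_path]; push_cast; linarith)).const_mul _
  refine hint.mono' (by fun_prop : Measurable _).aestronglyMeasurable (ae_of_all _ fun x => ?_)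
  have hn := pathNorm_nonneg x
  have hpos : 0 < 1 + pathNorm x ^ p := by positivity
  rw [Real.norm_of_nonneg (by positivity), div_le_iff₀ hpos]
  have h1 := add_rpow_le_two_rpow_mul hp0 zero_le_one hn
  rw [Real.one_rpow] at h1
  calc (pathNorm x + 1 / 2) ^ 2 ≤ (1 + pathNorm x) ^ (2 : ℝ) := by
        rw [Real.rpow_two]; exact pow_le_pow_left₀ (by positivity) (by linarith) 2
    _ = (1 + pathNorm x) ^ (-(p - 2)) * (1 + pathNorm x) ^ p := by
        rw [← Real.rpow_add (by positivity)]; congr 1; ring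
    _ ≤ (1 + ‖x‖) ^ (-(p - 2)) * (2 ^ p * (1 + pathNorm x ^ p)) := by
        gcongr ?_ * ?_
        exact Real.rpow_le_rpow_of_nonpos (by positivity) (by linarith [norm_le_pathNorm x])
          (by have : (0 : ℝ) ≤ d * T := by positivity
              linarith)
    _ = _ := by ring

theorem integral_weight_pos {p : ℝ} (hp : (d * T + 2 : ℝ) < p) :
    0 < ∫ x : Path d T, (pathNorm x + 1 / 2) ^ 2 / (1 + pathNorm x ^ p) := by
  have hpos : ∀ x : Path d T, 0 < (pathNorm x + 1 / 2) ^ 2 / (1 + pathNorm x ^ p) := fun x => by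
    have hn := pathNorm_nonneg x
    positivity
  rw [integral_pos_iff_support_of_nonneg (fun x => (hpos x).le) (integrable_weight hp)]
  have : Function.support (fun x : Path d T => (pathNorm x + 1 / 2) ^ 2 / (1 + pathNorm x ^ p))
      = Set.univ := Set.eq_univ_of_forall fun x => (hpos x).ne'
  rw [this]
  exact Measure.measure_univ_pos.2 (NeZero.ne _)

theorem gaussianDensity_one_le_one (x : Path d T) : gaussianDensity 1 x ≤ 1 := by
  refine (gaussianDensity_le x).trans (inv_le_one_of_one_le₀ ?_)
  rw [Real.one_le_sqrt]
  exact one_le_pow₀ (by nlinarith [Real.pi_gt_three])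

/-- One of the two density factors is bounded by `σ^(-dT)`, and the other is rescaled to `σ = 1`. -/
theorem lintegral_mul_gaussianDensity_sq_le {σ : ℝ} (hσ : 0 < σ) {F : Path d T → ℝ≥0∞}
    (hF : Measurable F) :
    ∫⁻ x, F x * ENNReal.ofReal (gaussianDensity σ x ^ 2) ≤ ENNReal.ofReal ((σ ^ (d * T))⁻¹) *
      ∫⁻ x, F (σ • x) * ENNReal.ofReal (gaussianDensity 1 x) := by
  have h1 : ∀ x : Path d T, F x * ENNReal.ofReal (gaussianDensity σ x ^ 2) =
      (F x * ENNReal.ofReal (gaussianDensity σ x)) * ENNReal.ofReal (gaussianDensity σ x) :=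
    fun x => by rw [sq, ENNReal.ofReal_mul (gaussianDensity_nonneg _ _), mul_assoc]
  simp only [h1]
  rw [lintegral_mul_gaussianDensity hσ (by fun_prop), ← lintegral_const_mul _ (by fun_prop)]
  refine lintegral_mono fun x => ?_
  have h2 : gaussianDensity σ (σ • x) ≤ (σ ^ (d * T))⁻¹ := by
    rw [← mul_one (σ ^ (d * T))⁻¹, le_inv_mul_iff₀ (by positivity), gaussianDensity_smul hσ]
    exact gaussianDensity_one_le_one x
  calc _ ≤ F (σ • x) * ENNReal.ofReal ((σ ^ (d * T))⁻¹) * ENNReal.ofReal (gaussianDensity 1 x) := by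
        gcongr
    _ = _ := by ring

theorem lintegral_one_add_rpow_mul_gaussianDensity_sq_le {σ : ℝ} (hσ : 0 < σ) {p : ℝ} (hp : 0 < p)
    (a : Path d T) :
    ∫⁻ x, ENNReal.ofReal (1 + pathNorm (x + a) ^ p) * ENNReal.ofReal (gaussianDensity σ x ^ 2) ≤
      ENNReal.ofReal ((σ ^ (d * T))⁻¹) * (ENNReal.ofReal (1 + 2 ^ p * pathNorm a ^ p) +
        ENNReal.ofReal (2 ^ p * σ ^ p) * gaussianMoment d T p) := by
  have hm := measurable_pathNorm (d := d) (T := T)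
  have hm' : Measurable fun x : Path d T => pathNorm (x + a) := hm.comp (by fun_prop)
  refine (lintegral_mul_gaussianDensity_sq_le hσ (by fun_prop)).trans ?_
  gcongr
  calc _ ≤ ∫⁻ x : Path d T, (ENNReal.ofReal (1 + 2 ^ p * pathNorm a ^ p) *
        ENNReal.ofReal (gaussianDensity 1 x) + ENNReal.ofReal (2 ^ p * σ ^ p) *
          (ENNReal.ofReal (pathNorm x ^ p) * ENNReal.ofReal (gaussianDensity 1 x))) := by
        refine lintegral_mono fun x => ?_
        have hx := pathNorm_nonneg x
        have ha := pathNorm_nonneg a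
        have h0 := pathNorm_nonneg (σ • x + a)
        rw [← mul_assoc, ← add_mul]
        gcongr
        rw [← ENNReal.ofReal_mul (by positivity),
          ← ENNReal.ofReal_add (by positivity) (by positivity)]
        refine ENNReal.ofReal_le_ofReal ?_
        calc 1 + pathNorm (σ • x + a) ^ p ≤ 1 + (σ * pathNorm x + pathNorm a) ^ p := by
              have := pathNorm_add_le (σ • x) a
              rw [pathNorm_smul hσ.le] at this
              gcongr
          _ ≤ 1 + 2 ^ p * ((σ * pathNorm x) ^ p + pathNorm a ^ p) := by
              gcongr
              exact add_rpow_le_two_rpow_mul hp.le (by positivity) ha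
          _ = _ := by rw [Real.mul_rpow hσ.le hx]; ring
    _ = _ := by
        rw [lintegral_add_left (by fun_prop), lintegral_const_mul _ (by fun_prop),
          lintegral_const_mul _ (by fun_prop), lintegral_gaussianDensity one_pos, mul_one,
          gaussianMoment]

theorem lintegral_weight_mul_gaussianDensity_le {σ : ℝ} (hσ : 0 < σ) (hσ1 : σ ≤ 1) {R : ℝ≥0}
    {a : Path d T} (ha : pathNorm a ≤ R) :
    ∫⁻ x, (ENNReal.ofReal (pathNorm x) + 1 / 2) * ENNReal.ofReal (gaussianDensity σ (x - a)) ≤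
      gaussianMoment d T 1 + R + 1 / 2 := by
  have hm := measurable_pathNorm (d := d) (T := T)
  have hm' : Measurable fun x : Path d T => pathNorm (x + a) := hm.comp (by fun_prop)
  have hm'' : Measurable fun x : Path d T => pathNorm (σ • x + a) := hm.comp (by fun_prop)
  rw [← lintegral_add_right_eq_self _ a]
  simp only [add_sub_cancel_right]
  rw [lintegral_mul_gaussianDensity hσ (F := fun x => ENNReal.ofReal (pathNorm (x + a)) + 1 / 2)
    (by fun_prop)]
  calc _ ≤ ∫⁻ x : Path d T, (ENNReal.ofReal (pathNorm x ^ (1 : ℝ)) *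
        ENNReal.ofReal (gaussianDensity 1 x) +
          (R + 1 / 2) * ENNReal.ofReal (gaussianDensity 1 x)) := by
        refine lintegral_mono fun x => ?_
        rw [← add_mul, Real.rpow_one, ← add_assoc]
        gcongr
        rw [← ENNReal.ofReal_coe_nnreal, ← ENNReal.ofReal_add (pathNorm_nonneg x) (NNReal.coe_nonneg R)]
        refine ENNReal.ofReal_le_ofReal ((pathNorm_add_le _ _).trans (add_le_add ?_ ha))
        rw [pathNorm_smul hσ.le]
        exact mul_le_of_le_one_left (pathNorm_nonneg x) hσ1
    _ = _ := by
        rw [lintegral_add_right _ (by fun_prop), lintegral_const_mul _ (by fun_prop),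
          lintegral_gaussianDensity one_pos, mul_one, gaussianMoment, add_assoc]

end Moments

/-! ### Mean error of the smoothed empirical density -/

section Empirical

theorem edelta_ofReal {a b : ℝ} (ha : 0 ≤ a) (hb : 0 ≤ b) :
    edelta (ENNReal.ofReal a) (ENNReal.ofReal b) = ENNReal.ofReal |a - b| := by
  rw [edelta, ← ENNReal.ofReal_sub _ hb, ← ENNReal.ofReal_sub _ ha]
  rcases le_total a b with h | h
  · rw [ENNReal.ofReal_of_nonpos (sub_nonpos.2 h), zero_add, abs_of_nonpos (sub_nonpos.2 h), neg_sub]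
  · rw [ENNReal.ofReal_of_nonpos (sub_nonpos.2 h), add_zero, abs_of_nonneg (sub_nonneg.2 h)]

/-- The mean square error of an empirical mean. -/
theorem lintegral_edelta_empirical_sq_le {α Ω : Type*} [MeasurableSpace α] [MeasurableSpace Ω]
    {P : Measure Ω} [IsProbabilityMeasure P] {μ : Measure α} [IsProbabilityMeasure μ] {N : ℕ}
    (hN : 1 ≤ N) {X : Fin N → Ω → α} (hX : ∀ i, Measurable (X i)) (hlaw : ∀ i, P.map (X i) = μ)
    (hind : iIndepFun X P) {h : α → ℝ} (hh : Measurable h) (h0 : ∀ a, 0 ≤ h a) {C : ℝ}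
    (hC : ∀ a, h a ≤ C) :
    ∫⁻ ω, edelta (∫⁻ a, ENNReal.ofReal (h a) ∂μ)
        ((N : ℝ≥0∞)⁻¹ * ∑ i, ENNReal.ofReal (h (X i ω))) ^ 2 ∂P ≤
      (N : ℝ≥0∞)⁻¹ * ∫⁻ a, ENNReal.ofReal (h a ^ 2) ∂μ := by
  have hNpos : (0 : ℝ) < N := by exact_mod_cast hN
  have hint : Integrable h μ := Integrable.of_bound hh.aestronglyMeasurable C
    (ae_of_all _ fun a => by rw [Real.norm_of_nonneg (h0 a)]; exact hC a)
  have hmem : ∀ i, MemLp (fun ω => h (X i ω)) 2 P := fun i =>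
    MemLp.of_bound (hh.comp (hX i)).aestronglyMeasurable C
      (ae_of_all _ fun a => by rw [Real.norm_of_nonneg (h0 _)]; exact hC _)
  set m := ∫ a, h a ∂μ with hm
  set S : Ω → ℝ := ∑ i, fun ω => h (X i ω) with hS
  have hSm : MemLp S 2 P := memLp_finsetSum' _ fun i _ => hmem i
  have hEi : ∀ i, ∫ ω, h (X i ω) ∂P = m := fun i => by
    rw [hm, ← hlaw i, integral_map (hX i).aemeasurable hh.aestronglyMeasurable]
  have hES : ∫ ω, (N : ℝ)⁻¹ * S ω ∂P = m := by
    rw [integral_const_mul]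
    simp only [hS, Finset.sum_apply]
    rw [integral_finsetSum _ fun i _ => (hmem i).integrable one_le_two]
    simp only [hEi, Finset.sum_const, Finset.card_univ, Fintype.card_fin, nsmul_eq_mul]
    field_simp
  -- Independence removes the cross terms, and each variance is at most the uncentred second moment.
  have hvar : Var[fun ω => (N : ℝ)⁻¹ * S ω; P] ≤ (N : ℝ)⁻¹ * ∫ a, h a ^ 2 ∂μ := by
    rw [variance_const_mul, hS, IndepFun.variance_sum (fun i _ => hmem i)
      (fun i _ j _ hij => (hind.indepFun hij).comp hh hh)]
    have hvi : ∀ i, Var[fun ω => h (X i ω); P] ≤ ∫ a, h a ^ 2 ∂μ := fun i => by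
      refine (variance_le_expectation_sq (hmem i).1).trans (le_of_eq ?_)
      rw [← hlaw i, integral_map (hX i).aemeasurable (hh.pow_const 2).aestronglyMeasurable]
      rfl
    calc _ ≤ ((N : ℝ)⁻¹) ^ 2 * ∑ _i : Fin N, ∫ a, h a ^ 2 ∂μ := by
          gcongr with i; exact hvi i
      _ = _ := by
          simp only [Finset.sum_const, Finset.card_univ, Fintype.card_fin, nsmul_eq_mul]
          field_simp
  have hpt : ∀ ω, edelta (∫⁻ a, ENNReal.ofReal (h a) ∂μ)
      ((N : ℝ≥0∞)⁻¹ * ∑ i, ENNReal.ofReal (h (X i ω))) ^ 2 =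
      ENNReal.ofReal (((N : ℝ)⁻¹ * S ω - m) ^ 2) := fun ω => by
    have hS0 : 0 ≤ S ω := by
      simp only [hS, Finset.sum_apply]; exact Finset.sum_nonneg fun i _ => h0 _
    rw [← ofReal_integral_eq_lintegral_ofReal hint (ae_of_all _ h0),
      ← ENNReal.ofReal_sum_of_nonneg (fun i _ => h0 _), ← ENNReal.ofReal_natCast,
      ← ENNReal.ofReal_inv_of_pos hNpos, ← ENNReal.ofReal_mul (by positivity),
      edelta_ofReal (integral_nonneg h0) (by
        have := Finset.sum_nonneg (s := Finset.univ) fun i _ => h0 (X i ω)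
        positivity), ← ENNReal.ofReal_pow (abs_nonneg _), sq_abs, ← neg_sub, neg_sq]
    simp [hS, hm]
  simp only [hpt]
  have hZ : MemLp (fun ω => (N : ℝ)⁻¹ * S ω) 2 P := hSm.const_mul _
  have hZ2 : Integrable (fun ω => ((N : ℝ)⁻¹ * S ω - m) ^ 2) P :=
    (hZ.sub (memLp_const m)).integrable_sq
  rw [← ofReal_integral_eq_lintegral_ofReal hZ2
      (ae_of_all _ fun ω => sq_nonneg _),
    ← ofReal_integral_eq_lintegral_ofReal (Integrable.of_bound (hh.pow_const 2).aestronglyMeasurable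
      (C ^ 2) (ae_of_all _ fun a => by
        rw [Real.norm_of_nonneg (sq_nonneg _)]
        exact pow_le_pow_left₀ (h0 a) (hC a) 2)) (ae_of_all _ fun a => sq_nonneg _),
    ← ENNReal.ofReal_natCast, ← ENNReal.ofReal_inv_of_pos hNpos, ← ENNReal.ofReal_mul (by positivity)]
  refine ENNReal.ofReal_le_ofReal (le_trans (le_of_eq ?_) hvar)
  rw [variance_eq_integral hZ.aemeasurable, hES]

/-- The weighted distance between the smoothed distribution `μ` and the smoothed empirical measure
of the points `y`. -/
noncomputable def empiricalDist (σ : ℝ) (μ : Measure (Path d T)) {N : ℕ} (y : Fin N → Path d T) :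
    ℝ≥0∞ :=
  weightedDist (mixtureDensity σ μ)
    (fun x => (N : ℝ≥0∞)⁻¹ * ∑ i, ENNReal.ofReal (gaussianDensity σ (x - y i)))

theorem mixtureDensity_empiricalMeasure (σ : ℝ) (N : ℕ) (y : ℕ → Path d T) :
    mixtureDensity σ (empiricalMeasure N y) =
      fun x => (N : ℝ≥0∞)⁻¹ * ∑ i : Fin N, ENNReal.ofReal (gaussianDensity σ (x - y i)) := by
  funext x
  rw [mixtureDensity, empiricalMeasure, lintegral_smul_measure, lintegral_finsetSum_measure,
    Finset.sum_range, smul_eq_mul]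
  congr 2
  funext i
  rw [lintegral_dirac' _ (by fun_prop)]

theorem measurable_uncurry_edelta_empirical (σ : ℝ) (μ : Measure (Path d T)) [SFinite μ] (N : ℕ) :
    Measurable fun q : (Fin N → Path d T) × Path d T => edelta (mixtureDensity σ μ q.2)
      ((N : ℝ≥0∞)⁻¹ * ∑ i, ENNReal.ofReal (gaussianDensity σ (q.2 - q.1 i))) := by
  have hm := measurable_mixtureDensity (σ := σ) μ
  refine measurable_edelta (by fun_prop) (Measurable.const_mul ?_ _)
  refine Finset.measurable_fun_sum _ fun i _ => ?_
  fun_prop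

theorem measurable_empiricalDist (σ : ℝ) (μ : Measure (Path d T)) [SFinite μ] (N : ℕ) :
    Measurable (empiricalDist σ μ (N := N)) := by
  have hm := measurable_uncurry_edelta_empirical σ μ N
  have hp := measurable_pathNorm (d := d) (T := T)
  exact Measurable.lintegral_prod_right' (f := fun q : (Fin N → Path d T) × Path d T =>
    (ENNReal.ofReal (pathNorm q.2) + 1 / 2) * edelta (mixtureDensity σ μ q.2)
      ((N : ℝ≥0∞)⁻¹ * ∑ i, ENNReal.ofReal (gaussianDensity σ (q.2 - q.1 i)))) (by fun_prop)

/-- The right side is the expression under the second root of `meanConst`: the factors `(2π)^(dT)`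
cancel those of `(2πσ)^(-dT)` and leave the `σ^(-dT)` from the squared density. -/
theorem lintegral_one_add_rpow_mul_gaussianDensity_sq_mixture_le {σ : ℝ} (hσ : 0 < σ) {p : ℝ}
    (hp : 0 < p) (μ : Measure (Path d T)) [IsProbabilityMeasure μ]
    (hM : Integrable (fun x => pathNorm x ^ p) μ) :
    ∫⁻ x, ENNReal.ofReal (1 + pathNorm x ^ p) *
        ∫⁻ a, ENNReal.ofReal (gaussianDensity σ (x - a) ^ 2) ∂μ ≤
      ENNReal.ofReal (((2 * Real.pi) ^ (d * T) * (2 ^ p * moment p μ + 1) +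
        (2 * Real.pi) ^ (d * T) * ((gaussianMoment d T p).toReal + 1) * 2 ^ p * σ ^ p) *
        (1 / (2 * Real.pi * σ) ^ (d * T))) := by
  have hm := measurable_pathNorm (d := d) (T := T)
  have h1 : ∀ x, ENNReal.ofReal (1 + pathNorm x ^ p) *
        ∫⁻ a, ENNReal.ofReal (gaussianDensity σ (x - a) ^ 2) ∂μ = ∫⁻ a,
          ENNReal.ofReal (1 + pathNorm x ^ p) * ENNReal.ofReal (gaussianDensity σ (x - a) ^ 2) ∂μ :=
    fun x => by rw [lintegral_const_mul _ (by fun_prop)]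
  have hM0 : 0 ≤ moment p μ := integral_nonneg fun x => Real.rpow_nonneg (pathNorm_nonneg x) p
  simp only [h1]
  rw [lintegral_lintegral_swap (by fun_prop)]
  calc _ ≤ ∫⁻ a, ENNReal.ofReal ((σ ^ (d * T))⁻¹) * (ENNReal.ofReal (1 + 2 ^ p * pathNorm a ^ p) +
        ENNReal.ofReal (2 ^ p * σ ^ p) * gaussianMoment d T p) ∂μ := by
        refine lintegral_mono fun a => ?_
        rw [← lintegral_add_right_eq_self _ a]
        simp only [add_sub_cancel_right]
        exact lintegral_one_add_rpow_mul_gaussianDensity_sq_le hσ hp a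
    _ = ENNReal.ofReal ((σ ^ (d * T))⁻¹) * (ENNReal.ofReal (1 + 2 ^ p * moment p μ) +
        ENNReal.ofReal (2 ^ p * σ ^ p) * ENNReal.ofReal (gaussianMoment d T p).toReal) := by
        have hI : Integrable (fun a => 1 + 2 ^ p * pathNorm a ^ p) μ :=
          (integrable_const _).add (hM.const_mul _)
        rw [lintegral_const_mul _ (by fun_prop), lintegral_add_right _ measurable_const,
          lintegral_const, measure_univ, mul_one, ENNReal.ofReal_toReal (gaussianMoment_lt_top hp).ne,
          ← ofReal_integral_eq_lintegral_ofReal hI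
            (ae_of_all _ fun x => by have := pathNorm_nonneg x; positivity),
          integral_add (integrable_const _) (hM.const_mul _), integral_const_mul]
        simp [moment]
    _ ≤ _ := by
        rw [← ENNReal.ofReal_mul (by positivity), ← ENNReal.ofReal_add (by positivity) (by positivity),
          ← ENNReal.ofReal_mul (by positivity)]
        refine ENNReal.ofReal_le_ofReal ?_
        have h2 : (0 : ℝ) < 2 ^ p * σ ^ p := by positivity
        have h3 : 0 < (2 * Real.pi) ^ (d * T) := by positivity
        have h4 : 0 < σ ^ (d * T) := by positivity
        rw [mul_pow (2 * Real.pi) σ]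
        have e : ((2 * Real.pi) ^ (d * T) * (2 ^ p * moment p μ + 1) +
            (2 * Real.pi) ^ (d * T) * ((gaussianMoment d T p).toReal + 1) * 2 ^ p * σ ^ p) *
            (1 / ((2 * Real.pi) ^ (d * T) * σ ^ (d * T))) = (σ ^ (d * T))⁻¹ *
            ((2 ^ p * moment p μ + 1) + ((gaussianMoment d T p).toReal + 1) * (2 ^ p * σ ^ p)) := by
          field_simp
        rw [e]
        refine mul_le_mul_of_nonneg_left ?_ (by positivity)
        linarith

/-- The Cauchy-Schwarz inequality for the weights `(‖x‖ + 1/2) / √(1 + ‖x‖ ^ p)` and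
`√(1 + ‖x‖ ^ p)`. -/
theorem lintegral_weight_mul_le {p : ℝ} (hp : (d * T + 2 : ℝ) < p) {Ω : Type*} [MeasurableSpace Ω]
    {P : Measure Ω} [IsProbabilityMeasure P] {Δ : Ω × Path d T → ℝ≥0∞} (hΔ : Measurable Δ)
    {S : ℝ≥0∞} (hS : ∫⁻ x, ENNReal.ofReal (1 + pathNorm x ^ p) * ∫⁻ ω, Δ (ω, x) ^ 2 ∂P ≤ S) :
    ∫⁻ ω, ∫⁻ x, (ENNReal.ofReal (pathNorm x) + 1 / 2) * Δ (ω, x) ∂volume ∂P ≤ ENNReal.ofReal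
      √(∫ x : Path d T, (pathNorm x + 1 / 2) ^ 2 / (1 + pathNorm x ^ p)) * S ^ (1 / 2 : ℝ) := by
  have hm := measurable_pathNorm (d := d) (T := T)
  have hk : ∀ x : Path d T, 0 < 1 + pathNorm x ^ p := fun x => by
    have := pathNorm_nonneg x; positivity
  let u : Ω × Path d T → ℝ≥0∞ := fun q =>
    ENNReal.ofReal ((pathNorm q.2 + 1 / 2) / √(1 + pathNorm q.2 ^ p))
  let v : Ω × Path d T → ℝ≥0∞ := fun q => ENNReal.ofReal √(1 + pathNorm q.2 ^ p) * Δ q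
  have hum : Measurable u := by fun_prop
  have hvm : Measurable v := by fun_prop
  have huv : ∀ q, (ENNReal.ofReal (pathNorm q.2) + 1 / 2) * Δ q = (u * v) q := fun q => by
    have h1 := pathNorm_nonneg q.2
    have h2 := Real.sqrt_pos.2 (hk q.2)
    simp only [Pi.mul_apply, u, v]
    rw [← mul_assoc, ← ENNReal.ofReal_mul (by positivity),
      div_mul_cancel₀ _ h2.ne', ENNReal.ofReal_add h1 (by norm_num)]
    congr 2
    rw [one_div, one_div, ENNReal.ofReal_inv_of_pos two_pos, ENNReal.ofReal_ofNat]
  have hu2 : ∫⁻ q, u q ^ (2 : ℝ) ∂(P.prod volume) =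
      ENNReal.ofReal (∫ x : Path d T, (pathNorm x + 1 / 2) ^ 2 / (1 + pathNorm x ^ p)) := by
    rw [lintegral_prod_symm _ (hum.pow_const _).aemeasurable]
    simp only [u, lintegral_const, measure_univ, mul_one]
    rw [ofReal_integral_eq_lintegral_ofReal (integrable_weight hp) (ae_of_all _ fun x => by
      have := pathNorm_nonneg x; positivity)]
    refine lintegral_congr fun x => ?_
    have h1 := pathNorm_nonneg x
    rw [ENNReal.rpow_two, ← ENNReal.ofReal_pow (by positivity), div_pow, Real.sq_sqrt (hk x).le]
  have hv2 : ∫⁻ q, v q ^ (2 : ℝ) ∂(P.prod volume) ≤ S := by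
    refine le_trans (le_of_eq ?_) hS
    rw [lintegral_prod_symm _ (hvm.pow_const _).aemeasurable]
    refine lintegral_congr fun x => ?_
    have hΔx : Measurable fun ω => Δ (ω, x) := hΔ.comp (by fun_prop)
    rw [← lintegral_const_mul _ (hΔx.pow_const 2)]
    refine lintegral_congr fun ω => ?_
    simp only [v]
    rw [ENNReal.rpow_two, mul_pow, ← ENNReal.ofReal_pow (by positivity), Real.sq_sqrt (hk x).le]
  calc _ = ∫⁻ q, (u * v) q ∂(P.prod volume) := by
        rw [lintegral_prod _ (hum.mul hvm).aemeasurable]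
        exact lintegral_congr fun ω => lintegral_congr fun x => huv (ω, x)
    _ ≤ (∫⁻ q, u q ^ (2 : ℝ) ∂(P.prod volume)) ^ (1 / 2 : ℝ) *
        (∫⁻ q, v q ^ (2 : ℝ) ∂(P.prod volume)) ^ (1 / 2 : ℝ) :=
        ENNReal.lintegral_mul_le_Lp_mul_Lq _ Real.HolderConjugate.two_two hum.aemeasurable
          hvm.aemeasurable
    _ ≤ _ := by
        rw [hu2, ENNReal.ofReal_rpow_of_nonneg (integral_weight_pos hp).le (by norm_num),
          ← Real.sqrt_eq_rpow]
        gcongr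

/-- The expected weighted distance decays like `N ^ (-1/2)`. -/
theorem lintegral_empiricalDist_le {σ : ℝ} (hσ : 0 < σ) {p : ℝ} (hp : (d * T + 2 : ℝ) < p)
    (μ : Measure (Path d T)) [IsProbabilityMeasure μ]
    (hM : Integrable (fun x => pathNorm x ^ p) μ) {Ω : Type*} [MeasurableSpace Ω]
    {P : Measure Ω} [IsProbabilityMeasure P] {N : ℕ}
    (hN : 1 ≤ N) {X : Fin N → Ω → Path d T} (hX : ∀ i, Measurable (X i))
    (hlaw : ∀ i, P.map (X i) = μ) (hind : iIndepFun X P) :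
    ∫⁻ ω, empiricalDist σ μ (fun i => X i ω) ∂P ≤ ENNReal.ofReal
      (meanConst d T ((2 * Real.pi) ^ (d * T))
        ((2 * Real.pi) ^ (d * T) * ((gaussianMoment d T p).toReal + 1)) σ p (moment p μ) *
        (N : ℝ) ^ (-(1 / 2) : ℝ)) := by
  have hNpos : (0 : ℝ) < N := by exact_mod_cast hN
  have hp0 : 0 < p := by have : (0 : ℝ) ≤ d * T := by positivity
                         linarith
  have hm := measurable_pathNorm (d := d) (T := T)
  have hM0 : 0 ≤ moment p μ := integral_nonneg fun x => Real.rpow_nonneg (pathNorm_nonneg x) p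
  have hmix := lintegral_one_add_rpow_mul_gaussianDensity_sq_mixture_le hσ hp0 μ hM
  set S := ((2 * Real.pi) ^ (d * T) * (2 ^ p * moment p μ + 1) +
        (2 * Real.pi) ^ (d * T) * ((gaussianMoment d T p).toReal + 1) * 2 ^ p * σ ^ p) *
        (1 / (2 * Real.pi * σ) ^ (d * T)) with hSdef
  have hS0 : 0 ≤ S := by positivity
  have hXm : Measurable fun q : Ω × Path d T => ((fun i => X i q.1), q.2) :=
    (measurable_pi_iff.2 fun i => (hX i).comp measurable_fst).prodMk measurable_snd
  have hsq : Measurable fun x : Path d T => ∫⁻ a, ENNReal.ofReal (gaussianDensity σ (x - a) ^ 2) ∂μ :=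
    Measurable.lintegral_prod_right' (f := fun q : Path d T × Path d T =>
      ENNReal.ofReal (gaussianDensity σ (q.1 - q.2) ^ 2)) (by fun_prop)
  refine (lintegral_weight_mul_le hp ((measurable_uncurry_edelta_empirical σ μ N).comp hXm)
    (S := (N : ℝ≥0∞)⁻¹ * ENNReal.ofReal S) ?_).trans (le_of_eq ?_)
  · calc _ ≤ ∫⁻ x : Path d T, (N : ℝ≥0∞)⁻¹ * (ENNReal.ofReal (1 + pathNorm x ^ p) *
          ∫⁻ a, ENNReal.ofReal (gaussianDensity σ (x - a) ^ 2) ∂μ) := by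
          refine lintegral_mono fun x => ?_
          rw [mul_left_comm]
          refine mul_le_mul_right ?_ _
          -- For fixed `x`, both densities at `x` are means of `a ↦ φ_σ(x - a)`, the true one and
          -- the empirical one.
          exact lintegral_edelta_empirical_sq_le hN hX hlaw hind
            (h := fun a => gaussianDensity σ (x - a)) (by fun_prop)
            (fun a => gaussianDensity_nonneg _ _) (fun a => gaussianDensity_le _)
      _ ≤ _ := by
          rw [lintegral_const_mul _ (by fun_prop)]
          gcongr
  · rw [← ENNReal.ofReal_natCast, ← ENNReal.ofReal_inv_of_pos hNpos,
      ← ENNReal.ofReal_mul (by positivity),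
      ENNReal.ofReal_rpow_of_nonneg (by positivity) (by norm_num),
      ← ENNReal.ofReal_mul (Real.sqrt_nonneg _), ← Real.sqrt_eq_rpow,
      Real.sqrt_mul (by positivity), meanConst, ← hSdef,
      Real.rpow_neg hNpos.le, ← Real.sqrt_eq_rpow, Real.sqrt_inv]
    congr 1
    ring

end Empirical

end AdaptedWasserstein

namespace AdaptedWasserstein

variable {d T : ℕ}

/-! ### Bounded differences of the weighted distance -/

section Deviation

theorem edelta_le_add (a b : ℝ≥0∞) : edelta a b ≤ a + b :=
  add_le_add tsub_le_self tsub_le_self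

theorem edelta_triangle (a b c : ℝ≥0∞) : edelta a c ≤ edelta a b + edelta b c := by
  calc edelta a c ≤ ((a - b) + (b - c)) + ((c - b) + (b - a)) :=
        add_le_add tsub_le_tsub_add_tsub tsub_le_tsub_add_tsub
    _ = _ := by simp only [edelta]; ring

variable {σ : ℝ} {R : ℝ≥0}

/-- A bound for the integral of the weight `‖x‖ + 1/2` against a smoothed distribution that is
supported in the ball of radius `R`. -/
noncomputable def weightBound (d T : ℕ) (R : ℝ≥0) : ℝ≥0 :=
  (gaussianMoment d T 1).toNNReal + R + 1 / 2

theorem coe_weightBound :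
    (weightBound d T R : ℝ≥0∞) = gaussianMoment d T 1 + R + 1 / 2 := by
  rw [weightBound]
  push_cast
  rw [ENNReal.coe_toNNReal (gaussianMoment_lt_top one_pos).ne]

theorem lintegral_weight_mul_mixtureDensity_le (hσ : 0 < σ) (hσ1 : σ ≤ 1)
    (μ : Measure (Path d T)) [IsProbabilityMeasure μ] (hμ : ∀ᵐ a ∂μ, pathNorm a ≤ R) :
    ∫⁻ x, (ENNReal.ofReal (pathNorm x) + 1 / 2) * mixtureDensity σ μ x ≤ weightBound d T R := by
  have hm := measurable_pathNorm (d := d) (T := T)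
  rw [lintegral_mul_mixtureDensity μ (by fun_prop)]
  calc _ ≤ ∫⁻ _a : Path d T, (weightBound d T R : ℝ≥0∞) ∂μ := by
        refine lintegral_mono_ae ?_
        filter_upwards [hμ] with a ha
        have := lintegral_weight_mul_gaussianDensity_le hσ hσ1 ha
        rw [← lintegral_add_right_eq_self _ a] at this
        simpa only [add_sub_cancel_right, coe_weightBound] using this
    _ = _ := by simp

theorem isProbabilityMeasure_empiricalMeasure {N : ℕ} (hN : 1 ≤ N) (y : ℕ → Path d T) :
    IsProbabilityMeasure (empiricalMeasure N y) := by
  refine ⟨?_⟩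
  have hN0 : (N : ℝ≥0∞) ≠ 0 := by exact_mod_cast (by omega : N ≠ 0)
  simp [empiricalMeasure, ENNReal.inv_mul_cancel hN0 (ENNReal.natCast_ne_top N)]

theorem ae_empiricalMeasure {N : ℕ} {y : ℕ → Path d T} {s : Set (Path d T)} (hs : MeasurableSet s)
    (hy : ∀ n, y n ∈ s) : ∀ᵐ a ∂(empiricalMeasure N y), a ∈ s := by
  rw [ae_iff]
  change empiricalMeasure N y sᶜ = 0
  simp [empiricalMeasure, hs, hy]

theorem empiricalDist_eq (N : ℕ) (μ : Measure (Path d T)) (y : ℕ → Path d T) :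
    empiricalDist σ μ (fun i : Fin N => y i) =
      weightedDist (mixtureDensity σ μ) (mixtureDensity σ (empiricalMeasure N y)) := by
  rw [mixtureDensity_empiricalMeasure, empiricalDist]

theorem weightedDist_le_add {f g : Path d T → ℝ≥0∞} (hf : Measurable f) :
    weightedDist f g ≤ (∫⁻ x, (ENNReal.ofReal (pathNorm x) + 1 / 2) * f x) +
      ∫⁻ x, (ENNReal.ofReal (pathNorm x) + 1 / 2) * g x := by
  have hm := measurable_pathNorm (d := d) (T := T)
  rw [weightedDist, ← lintegral_add_left (by fun_prop)]
  refine lintegral_mono fun x => ?_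
  rw [← mul_add]
  gcongr
  exact edelta_le_add _ _

theorem empiricalDist_le (hσ : 0 < σ) (hσ1 : σ ≤ 1) (μ : Measure (Path d T))
    [IsProbabilityMeasure μ] (hμ : ∀ᵐ a ∂μ, pathNorm a ≤ R) {N : ℕ} (hN : 1 ≤ N)
    {y : Fin N → Path d T} (hy : ∀ i, pathNorm (y i) ≤ R) :
    empiricalDist σ μ y ≤ 2 * weightBound d T R := by
  have h0 : 0 < N := hN
  -- Empirical measures are built from sequences; repeating the first point keeps the extension
  -- within radius `R`.
  let y' : ℕ → Path d T := fun n => if h : n < N then y ⟨n, h⟩ else y ⟨0, h0⟩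
  have hy' : (fun i : Fin N => y' i) = y := by funext i; simp [y']
  have hyR : ∀ n, y' n ∈ {a : Path d T | pathNorm a ≤ R} := fun n => by
    simp only [y']; split_ifs <;> exact hy _
  have := isProbabilityMeasure_empiricalMeasure hN y'
  have hs := ae_empiricalMeasure (N := N) (measurableSet_le measurable_pathNorm measurable_const) hyR
  rw [← hy', empiricalDist_eq, two_mul]
  exact (weightedDist_le_add (measurable_mixtureDensity μ)).trans (add_le_add
    (lintegral_weight_mul_mixtureDensity_le hσ hσ1 μ hμ)
    (lintegral_weight_mul_mixtureDensity_le hσ hσ1 _ hs))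

theorem edelta_sum_update_le {ι α : Type*} [Fintype ι] [DecidableEq ι] (k : α → ℝ≥0∞) (y : ι → α)
    (i : ι) (a : α) :
    edelta (∑ j, k (y j)) (∑ j, k (Function.update y i a j)) ≤ k (y i) + k a := by
  have h1 : ∑ j, k (y j) = k (y i) + ∑ j ∈ Finset.univ.erase i, k (y j) :=
    (Finset.add_sum_erase _ _ (Finset.mem_univ i)).symm
  have h2 : ∑ j, k (Function.update y i a j) = k a + ∑ j ∈ Finset.univ.erase i, k (y j) := by
    rw [← Finset.add_sum_erase _ _ (Finset.mem_univ i), Function.update_self]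
    congr 1
    refine Finset.sum_congr rfl fun j hj => ?_
    rw [Function.update_of_ne (Finset.ne_of_mem_erase hj)]
  rw [h1, h2, edelta]
  refine add_le_add ?_ ?_
  · rw [tsub_le_iff_right]
    gcongr
    exact le_add_self
  · rw [tsub_le_iff_right]
    gcongr
    exact le_add_self

theorem edelta_mul_left {c : ℝ≥0∞} (hc : c ≠ ∞) (a b : ℝ≥0∞) :
    edelta (c * a) (c * b) = c * edelta a b := by
  rw [edelta, edelta, mul_add, ENNReal.mul_sub fun _ _ => hc, ENNReal.mul_sub fun _ _ => hc]

/-- Moving one point exchanges two Gaussian bumps of mass `1/N`, each of weighted mass at most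
`weightBound d T R / N`. -/
theorem empiricalDist_update_le (hσ : 0 < σ) (hσ1 : σ ≤ 1) (μ : Measure (Path d T))
    [IsProbabilityMeasure μ] {N : ℕ} (hN : 1 ≤ N) (y : Fin N → Path d T) (i : Fin N)
    (a : Path d T) (hi : pathNorm (y i) ≤ R) (ha : pathNorm a ≤ R) :
    empiricalDist σ μ (Function.update y i a) ≤ empiricalDist σ μ y +
      (N : ℝ≥0∞)⁻¹ * (2 * weightBound d T R) := by
  have hm := measurable_pathNorm (d := d) (T := T)
  have hmix := measurable_mixtureDensity (σ := σ) μ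
  have hN0 : (N : ℝ≥0∞) ≠ 0 := by exact_mod_cast (by omega : N ≠ 0)
  have hms : ∀ z : Fin N → Path d T, Measurable fun x : Path d T =>
      (N : ℝ≥0∞)⁻¹ * ∑ j, ENNReal.ofReal (gaussianDensity σ (x - z j)) := fun z =>
    Measurable.const_mul (Finset.measurable_fun_sum _ fun j _ => by fun_prop) _
  have hd := measurable_edelta hmix (hms y)
  have hg : ∀ b : Path d T, Measurable fun x => ENNReal.ofReal (gaussianDensity σ (x - b)) :=
    fun b => by fun_prop
  unfold empiricalDist weightedDist
  calc _ ≤ ∫⁻ x, ((ENNReal.ofReal (pathNorm x) + 1 / 2) * edelta (mixtureDensity σ μ x)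
        ((N : ℝ≥0∞)⁻¹ * ∑ j, ENNReal.ofReal (gaussianDensity σ (x - y j))) +
        (N : ℝ≥0∞)⁻¹ * ((ENNReal.ofReal (pathNorm x) + 1 / 2) *
            ENNReal.ofReal (gaussianDensity σ (x - y i)) +
          (ENNReal.ofReal (pathNorm x) + 1 / 2) *
            ENNReal.ofReal (gaussianDensity σ (x - a)))) := by
        refine lintegral_mono fun x => ?_
        have h1 := edelta_triangle (mixtureDensity σ μ x)
          ((N : ℝ≥0∞)⁻¹ * ∑ j, ENNReal.ofReal (gaussianDensity σ (x - y j)))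
          ((N : ℝ≥0∞)⁻¹ * ∑ j, ENNReal.ofReal (gaussianDensity σ (x - Function.update y i a j)))
        rw [edelta_mul_left (ENNReal.inv_ne_top.2 hN0)] at h1
        have h2 := edelta_sum_update_le (fun b => ENNReal.ofReal (gaussianDensity σ (x - b))) y i a
        calc _ ≤ (ENNReal.ofReal (pathNorm x) + 1 / 2) * (edelta (mixtureDensity σ μ x)
              ((N : ℝ≥0∞)⁻¹ * ∑ j, ENNReal.ofReal (gaussianDensity σ (x - y j))) +
              (N : ℝ≥0∞)⁻¹ * (ENNReal.ofReal (gaussianDensity σ (x - y i)) +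
                ENNReal.ofReal (gaussianDensity σ (x - a)))) := by
              gcongr
              exact h1.trans (by gcongr)
          _ = _ := by ring
    _ = (∫⁻ x, (ENNReal.ofReal (pathNorm x) + 1 / 2) * edelta (mixtureDensity σ μ x)
        ((N : ℝ≥0∞)⁻¹ * ∑ j, ENNReal.ofReal (gaussianDensity σ (x - y j)))) +
        (N : ℝ≥0∞)⁻¹ * ((∫⁻ x, (ENNReal.ofReal (pathNorm x) + 1 / 2) *
            ENNReal.ofReal (gaussianDensity σ (x - y i))) +
          ∫⁻ x, (ENNReal.ofReal (pathNorm x) + 1 / 2) *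
            ENNReal.ofReal (gaussianDensity σ (x - a))) := by
        have := hg (y i)
        have := hg a
        rw [lintegral_add_left (by fun_prop), lintegral_const_mul _ (by fun_prop),
          lintegral_add_left (by fun_prop)]
    _ ≤ _ := by
        rw [two_mul, coe_weightBound]
        gcongr
        · exact lintegral_weight_mul_gaussianDensity_le hσ hσ1 hi
        · exact lintegral_weight_mul_gaussianDensity_le hσ hσ1 ha

/-- Sub-Gaussian concentration of the weighted distance, for points confined to a bounded set by a
map `r`. -/
theorem hasSubgaussianMGF_empiricalDist (hσ : 0 < σ) (hσ1 : σ ≤ 1) (μ : Measure (Path d T))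
    [IsProbabilityMeasure μ] (hμ : ∀ᵐ a ∂μ, pathNorm a ≤ R) {r : Path d T → Path d T}
    (hr : Measurable r) (hrR : ∀ a, pathNorm (r a) ≤ R) {N : ℕ} (hN : 1 ≤ N) :
    HasSubgaussianMGF (fun y : Fin N → Path d T =>
        (empiricalDist σ μ (fun i => r (y i))).toReal -
          ∫ z : Fin N → Path d T, (empiricalDist σ μ (fun i => r (z i))).toReal ∂(Measure.pi fun _ => μ))
      (N * ((N : ℝ≥0)⁻¹ * (2 * weightBound d T R)) ^ 2) (Measure.pi fun _ => μ) := by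
  have hN0 : (N : ℝ≥0) ≠ 0 := by exact_mod_cast (by omega : N ≠ 0)
  have hle : ∀ y : Fin N → Path d T,
      empiricalDist σ μ (fun i => r (y i)) ≤ ((2 * weightBound d T R : ℝ≥0) : ℝ≥0∞) := fun y => by
    push_cast
    exact empiricalDist_le hσ hσ1 μ hμ hN fun i => hrR _
  have hfin : ∀ y : Fin N → Path d T, empiricalDist σ μ (fun i => r (y i)) ≠ ∞ := fun y =>
    ((hle y).trans_lt ENNReal.coe_lt_top).ne
  have hcoe : (N : ℝ≥0∞)⁻¹ * (2 * weightBound d T R) =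
      (((N : ℝ≥0)⁻¹ * (2 * weightBound d T R) : ℝ≥0) : ℝ≥0∞) := by
    push_cast [ENNReal.coe_inv hN0]; rfl
  have hstep : ∀ (y : Fin N → Path d T) i a,
      (empiricalDist σ μ (fun j => r (Function.update y i a j))).toReal ≤
        (empiricalDist σ μ (fun j => r (y j))).toReal +
          ((N : ℝ≥0)⁻¹ * (2 * weightBound d T R) : ℝ≥0) := fun y i a => by
    have h := empiricalDist_update_le hσ hσ1 μ hN (fun j => r (y j)) i (r a) (hrR _) (hrR _)
    have e : Function.update (fun j => r (y j)) i (r a) = fun j => r (Function.update y i a j) := by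
      funext j
      by_cases hj : j = i
      · subst hj; simp
      · simp [hj]
    rw [e, hcoe] at h
    have h' := ENNReal.toReal_mono (ENNReal.add_ne_top.2 ⟨hfin y, ENNReal.coe_ne_top⟩) h
    rwa [ENNReal.toReal_add (hfin y) ENNReal.coe_ne_top, ENNReal.coe_toReal] at h'
  refine hasSubgaussianMGF_of_bounded_differences (μ := μ) (C := (2 * weightBound d T R : ℝ≥0))
    ?_ (fun y => ?_) (fun y i a => ?_)
  · exact ((measurable_empiricalDist σ μ N).comp (by fun_prop)).ennreal_toReal
  · rw [abs_of_nonneg ENNReal.toReal_nonneg]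
    exact ENNReal.toReal_le_coe_of_le_coe (hle y)
  · rw [abs_le]
    have h1 := hstep y i a
    -- The reverse inequality, by moving the point back.
    have h2 := hstep (Function.update y i a) i (y i)
    rw [Function.update_idem, Function.update_eq_self] at h2
    exact ⟨by linarith, by linarith⟩

end Deviation

/-! ### Assembly of the two bounds -/

section Main

theorem meanConst_pos {C₁ C₂ σ p M : ℝ} (hC₁ : 0 < C₁) (hC₂ : 0 < C₂) (hσ : 0 < σ)
    (hp : (d * T + 2 : ℝ) < p) (hM : 0 ≤ M) : 0 < meanConst d T C₁ C₂ σ p M := by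
  unfold meanConst
  exact mul_pos (Real.sqrt_pos.2 (integral_weight_pos hp)) (Real.sqrt_pos.2 (by positivity))

theorem continuous_pathNorm : Continuous (pathNorm (d := d) (T := T)) := by
  unfold pathNorm; fun_prop

/-- For `σ ≤ 1` one has `(1 + 2‖x‖) / (2σ) ≥ ‖x‖ + 1/2`. Compactness bounds the family, so that the
real supremum dominates its members. -/
theorem le_deviationConst {c₁ σ : ℝ} (hc₁ : 0 ≤ c₁) (hσ : 0 < σ) (hσ1 : σ ≤ 1)
    {K : Set (Path d T)} (hK : IsCompact K) {x : Path d T} (hx : x ∈ K) :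
    c₁ * (pathNorm x + 3 / 2) ≤ deviationConst c₁ σ K := by
  have hbdd : BddAbove (Set.range fun x : K => (1 + 2 * pathNorm (x : Path d T)) / (2 * σ)) := by
    have := hK.bddAbove_image (f := fun x : Path d T => (1 + 2 * pathNorm x) / (2 * σ))
      (by have := continuous_pathNorm (d := d) (T := T); fun_prop)
    rwa [Set.image_eq_range] at this
  have h1 := le_ciSup hbdd ⟨x, hx⟩
  have h2 : pathNorm x + 1 / 2 ≤ (1 + 2 * pathNorm x) / (2 * σ) := by
    have := pathNorm_nonneg x
    rw [le_div_iff₀ (by positivity)]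
    nlinarith
  simp only at h1
  exact mul_le_mul_of_nonneg_left (by linarith) hc₁

/-- Attainment matters: it lets `deviationConst` be bounded below in terms of the same `R` that
enters `weightBound`. -/
theorem exists_radius {K : Set (Path d T)} (hK : IsCompact K) : ∃ R : ℝ≥0,
    (∀ x ∈ K, pathNorm x ≤ R) ∧ (K.Nonempty → ∃ x ∈ K, pathNorm x = R) := by
  rcases K.eq_empty_or_nonempty with rfl | hne
  · exact ⟨0, by simp, fun h => absurd h Set.not_nonempty_empty⟩
  · obtain ⟨x, hx, hmax⟩ := hK.exists_isMaxOn hne continuous_pathNorm.continuousOn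
    exact ⟨⟨pathNorm x, pathNorm_nonneg x⟩, fun y hy => hmax hy, fun _ => ⟨x, hx, rfl⟩⟩

/-- The two bounds of the theorem, for a radius `R`, a constant `A` which bounds the smoothed
adapted Wasserstein distance by the weighted distance, and any `C_K ≥ A`. -/
theorem mean_and_deviation_bound {R A : ℝ≥0} {σ : ℝ} (hσ : 0 < σ) (hσ1 : σ ≤ 1)
    (hA : ∀ μ ν : Measure (Path d T), IsProbabilityMeasure μ → IsProbabilityMeasure ν →
      (∀ᵐ a ∂μ, ∀ t, ‖a t‖ₑ ≤ R) → (∀ᵐ a ∂ν, ∀ t, ‖a t‖ₑ ≤ R) →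
      smoothedAdaptedWasserstein σ μ ν ≤
        A * weightedDist (mixtureDensity σ μ) (mixtureDensity σ ν))
    {K : Set (Path d T)} (hK : IsCompact K) (hR : ∀ x ∈ K, pathNorm x ≤ R) (hne : K.Nonempty)
    {μ : Measure (Path d T)} [IsProbabilityMeasure μ] (hμK : μ Kᶜ = 0)
    {m b C : ℝ} (hm : 0 ≤ m) (hC : 0 < C) (hAC : A ≤ C)
    (hb : 8 * (weightBound d T R : ℝ) ^ 2 ≤ b ^ 2)
    {Ω : Type*} [MeasurableSpace Ω] {P : Measure Ω} [IsProbabilityMeasure P]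
    {X : ℕ → Ω → Path d T} (hX : ∀ n, Measurable (X n)) (hlaw : ∀ n, P.map (X n) = μ)
    (hind : iIndepFun X P) {N : ℕ} (hN : 1 ≤ N)
    (hmean : ∫⁻ ω, empiricalDist σ μ (fun i : Fin N => X i ω) ∂P ≤ ENNReal.ofReal m) :
    expectation P (fun ω => smoothedAdaptedWasserstein σ μ (empiricalMeasure N fun n => X n ω)) ≤
        ENNReal.ofReal (C * m) ∧
      ∀ x : ℝ, 0 < x →
        P {ω | ENNReal.ofReal (x + C * m) ≤
          smoothedAdaptedWasserstein σ μ (empiricalMeasure N fun n => X n ω)} ≤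
        ENNReal.ofReal (Real.exp (-((N : ℝ) * x ^ 2) / (C ^ 2 * b ^ 2))) := by
  classical
  have hNpos : (0 : ℝ) < N := by exact_mod_cast hN
  have hKm : MeasurableSet K := hK.measurableSet
  obtain ⟨k₀, hk₀⟩ := hne
  -- The null event that some sample leaves `K`; outside it the weighted distance dominates the
  -- adapted distance pointwise.
  set bad : Set Ω := ⋃ n, X n ⁻¹' Kᶜ with hbad
  have hbadm : MeasurableSet bad := MeasurableSet.iUnion fun n => hX n hKm.compl
  have hbad0 : P bad = 0 := measure_iUnion_null fun n => by
    rw [← Measure.map_apply (hX n) hKm.compl, hlaw, hμK]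
  have hgood : ∀ ω, ω ∉ bad → ∀ n, X n ω ∈ K := fun ω hω n => by
    by_contra h
    exact hω (Set.mem_iUnion.2 ⟨n, h⟩)
  have hsupp : ∀ {ν : Measure (Path d T)}, (∀ᵐ a ∂ν, a ∈ K) → ∀ᵐ a ∂ν, ∀ t, ‖a t‖ₑ ≤ R := fun h => by
    filter_upwards [h] with a ha t
    rw [← ofReal_norm, ← ENNReal.ofReal_coe_nnreal]
    exact ENNReal.ofReal_le_ofReal (((norm_le_pi_norm a t).trans (norm_le_pathNorm a)).trans (hR a ha))
  have hμK' : ∀ᵐ a ∂μ, a ∈ K := by rwa [ae_iff]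
  have hdom : ∀ ω, ω ∉ bad → smoothedAdaptedWasserstein σ μ (empiricalMeasure N fun n => X n ω) ≤
      A * empiricalDist σ μ (fun i : Fin N => X i ω) := fun ω hω => by
    rw [empiricalDist_eq N μ fun n => X n ω]
    exact hA μ _ inferInstance (isProbabilityMeasure_empiricalMeasure hN _) (hsupp hμK')
      (hsupp (ae_empiricalMeasure hKm (hgood ω hω)))
  have hXN : Measurable fun ω => fun i : Fin N => X i ω := measurable_pi_iff.2 fun i => hX i
  have hDm : Measurable fun ω => empiricalDist σ μ (fun i : Fin N => X i ω) :=
    (measurable_empiricalDist σ μ N).comp hXN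
  have hC' : (A : ℝ≥0∞) ≤ ENNReal.ofReal C := by
    rw [← ENNReal.ofReal_coe_nnreal]; exact ENNReal.ofReal_le_ofReal hAC
  constructor
  -- A measurable majorant for the outer expectation, set to `∞` on the null event where the
  -- comparison may fail.
  · refine iInf_le_of_le (fun ω => A * empiricalDist σ μ (fun i : Fin N => X i ω) +
      bad.indicator (fun _ => ∞) ω) (iInf_le_of_le
        ((hDm.const_mul _).add (measurable_const.indicator hbadm)) (iInf_le_of_le (fun ω => ?_) ?_))
    · by_cases hω : ω ∈ bad
      · simp [hω]
      · exact (hdom ω hω).trans le_self_add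
    · rw [lintegral_add_left (hDm.const_mul _), lintegral_indicator hbadm, setLIntegral_const,
        hbad0, mul_zero, add_zero, lintegral_const_mul _ hDm, ENNReal.ofReal_mul hC.le]
      gcongr
  · intro x hx
    -- Bounded differences are required for all points, whereas samples lie in `K` only almost
    -- surely; `r` retracts onto `K` and does not move good samples.
    set r : Path d T → Path d T := K.piecewise id fun _ => k₀ with hr
    have hrm : Measurable r := measurable_id.piecewise hKm measurable_const
    have hrK : ∀ a, r a ∈ K := fun a => by
      by_cases ha : a ∈ K <;> simp [hr, ha, hk₀]
    have hrid : ∀ a ∈ K, r a = a := fun a ha => by simp [hr, ha]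
    have hrR : ∀ a, pathNorm (r a) ≤ R := fun a => hR _ (hrK a)
    have hμR : ∀ᵐ a ∂μ, pathNorm a ≤ R := by filter_upwards [hμK'] with a ha using hR a ha
    have hsub := hasSubgaussianMGF_empiricalDist hσ hσ1 μ hμR hrm hrR hN
    set F : (Fin N → Path d T) → ℝ := fun y => (empiricalDist σ μ (fun i => r (y i))).toReal with hF
    have hFm : Measurable F :=
      ((measurable_empiricalDist σ μ N).comp (by fun_prop)).ennreal_toReal
    have hpi : P.map (fun ω => fun i : Fin N => X i ω) = Measure.pi fun _ => μ := by
      have h := (iIndepFun_iff_map_fun_eq_pi_map (f := fun i : Fin N => X i)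
        fun i => (hX i).aemeasurable).1 (hind.precomp Fin.val_injective)
      simpa only [hlaw] using h
    have hFX : ∀ ω, ω ∉ bad → ENNReal.ofReal (F fun i => X i ω) =
        empiricalDist σ μ (fun i : Fin N => X i ω) := fun ω hω => by
      have e : (fun i : Fin N => r (X i ω)) = fun i : Fin N => X i ω :=
        funext fun i => hrid _ (hgood ω hω i)
      have hlt : empiricalDist σ μ (fun i : Fin N => r (X i ω)) ≠ ∞ :=
        ((empiricalDist_le hσ hσ1 μ hμR hN fun i => hrR _).trans_lt
          (ENNReal.mul_lt_top ENNReal.ofNat_lt_top ENNReal.coe_lt_top)).ne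
      rw [hF, ENNReal.ofReal_toReal hlt, e]
    have hbadae : ∀ᵐ ω ∂P, ω ∉ bad := measure_eq_zero_iff_ae_notMem.1 hbad0
    have hEF : ∫ y, F y ∂(Measure.pi fun _ => μ) ≤ m := by
      rw [← hpi, integral_map hXN.aemeasurable hFm.aestronglyMeasurable,
        integral_eq_lintegral_of_nonneg_ae (ae_of_all _ fun ω => ENNReal.toReal_nonneg)
          (hFm.comp hXN).aestronglyMeasurable]
      refine ENNReal.toReal_le_of_le_ofReal hm (le_trans (le_of_eq ?_) hmean)
      refine lintegral_congr_ae ?_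
      filter_upwards [hbadae] with ω hω using hFX ω hω
    have htail := hsub.measure_ge_le (ε := x / C) (by positivity)
    set t : Set (Fin N → Path d T) :=
      {y | x / C ≤ F y - ∫ z, F z ∂(Measure.pi fun _ => μ)} with ht
    have htm : MeasurableSet t := measurableSet_le measurable_const (hFm.sub_const _)
    have hincl : {ω | ENNReal.ofReal (x + C * m) ≤
        smoothedAdaptedWasserstein σ μ (empiricalMeasure N fun n => X n ω)} ⊆
        bad ∪ (fun ω => fun i : Fin N => X i ω) ⁻¹' t := fun ω hω => by
      by_cases hb : ω ∈ bad
      · exact Or.inl hb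
      · refine Or.inr ?_
        have h1 : ENNReal.ofReal (x + C * m) ≤ ENNReal.ofReal (C * F fun i => X i ω) := by
          rw [ENNReal.ofReal_mul hC.le, hFX ω hb]
          exact (le_trans hω (hdom ω hb)).trans (by gcongr)
        have h2 : x + C * m ≤ C * F fun i => X i ω :=
          (ENNReal.ofReal_le_ofReal_iff (mul_nonneg hC.le ENNReal.toReal_nonneg)).1 h1
        change x / C ≤ (F fun i => X i ω) - _
        have h3 : x / C + m ≤ F fun i => X i ω := by
          rw [← sub_nonneg] at h2 ⊢
          have e : (F fun i => X i ω) - (x / C + m) = (C * (F fun i => X i ω) - (x + C * m)) / C := by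
            field_simp
          rw [e]; positivity
        linarith
    refine (measure_mono hincl).trans ((measure_union_le _ _).trans ?_)
    rw [hbad0, zero_add, ← Measure.map_apply hXN htm, hpi, ← ofReal_measureReal]
    refine ENNReal.ofReal_le_ofReal (htail.trans (Real.exp_le_exp.2 ?_))
    have hD : 0 < (weightBound d T R : ℝ) := by
      have : (0 : ℝ≥0) < weightBound d T R := by unfold weightBound; positivity
      exact_mod_cast this
    push_cast
    rw [neg_div, neg_div, neg_le_neg_iff]
    -- The variance proxy is `N (2W/N)² = 4W²/N`, which is where the `8W²` of `hb` comes from.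
    have e : (x / C) ^ 2 / (2 * (N * ((N : ℝ)⁻¹ * (2 * weightBound d T R)) ^ 2)) =
        N * x ^ 2 / (C ^ 2 * (8 * (weightBound d T R : ℝ) ^ 2)) := by
      field_simp
      ring
    rw [e]
    gcongr

end Main

end AdaptedWasserstein

theorem theorem4p4 {d T : ℕ} (hd : 1 ≤ d) (hT : 1 ≤ T) :
    -- `c₁` depends on `d, T` only, and `C₁ p`, `C₂ p` on `d, T, p` only
    ∃ (c₁ : ℝ) (C₁ C₂ : ℝ → ℝ), 0 < c₁ ∧ (∀ p, 0 < C₁ p ∧ 0 < C₂ p) ∧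
    ∀ K : Set (AdaptedWasserstein.Path d T), IsCompact K →
    ∃ C_K : ℝ, 0 < C_K ∧
    ∀ (μ : Measure (AdaptedWasserstein.Path d T)), IsProbabilityMeasure μ → μ Kᶜ = 0 →
    ∀ σ : ℝ, 0 < σ → σ ≤ 1 →
    ∀ p : ℝ, (d * T + 2 : ℝ) < p →
    ∀ C c : ℝ,
      C = AdaptedWasserstein.meanConst d T (C₁ p) (C₂ p) σ p (AdaptedWasserstein.moment p μ) →
      c = AdaptedWasserstein.deviationConst c₁ σ K →
      0 < C ∧ 0 < c ∧
      ∀ (Ω : Type*) [MeasurableSpace Ω] (P : Measure Ω) [IsProbabilityMeasure P]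
        (X : ℕ → Ω → AdaptedWasserstein.Path d T),
        (∀ n, Measurable (X n)) → (∀ n, P.map (X n) = μ) → iIndepFun X P →
        ∀ N : ℕ, 1 ≤ N →
          AdaptedWasserstein.expectation P (fun ω =>
              AdaptedWasserstein.smoothedAdaptedWasserstein σ μ
                (AdaptedWasserstein.empiricalMeasure N (fun n => X n ω)))
            ≤ ENNReal.ofReal (C_K * C * (N : ℝ) ^ (-(1 / 2) : ℝ)) ∧
          ∀ x : ℝ, 0 < x →
            P {ω | ENNReal.ofReal (x + C_K * C * (N : ℝ) ^ (-(1 / 2) : ℝ)) ≤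
                AdaptedWasserstein.smoothedAdaptedWasserstein σ μ
                  (AdaptedWasserstein.empiricalMeasure N (fun n => X n ω))}
              ≤ ENNReal.ofReal (Real.exp (-((N : ℝ) * x ^ 2) / (C_K ^ 2 * c ^ 2))) := by
  -- The factor `3` in `c₁` serves `8W² ≤ (3W)²`. The summand `+ 1` in `C₂` makes it positive for
  -- every real `p`, even where the moment might be infinite and `toReal` returns `0`.
  refine ⟨3 * (1 + (AdaptedWasserstein.gaussianMoment d T 1).toReal),
    fun _ => (2 * Real.pi) ^ (d * T), fun p => (2 * Real.pi) ^ (d * T) *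
      ((AdaptedWasserstein.gaussianMoment d T p).toReal + 1), by positivity,
    fun p => ⟨by positivity, by positivity⟩, fun K hK => ?_⟩
  obtain ⟨R, hR, hRne⟩ := AdaptedWasserstein.exists_radius hK
  obtain ⟨A, hA⟩ := AdaptedWasserstein.exists_smoothedAdaptedWasserstein_le d T R
  -- Any constant above `A` works; `A + 1` is moreover positive.
  refine ⟨A + 1, by positivity, fun μ _ hμK σ hσ hσ1 p hp C c hC hc => ?_⟩
  have hne : K.Nonempty := by
    by_contra h
    rw [Set.not_nonempty_iff_eq_empty] at h
    simp [h] at hμK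
  obtain ⟨k, hk, hkR⟩ := hRne hne
  have hM0 : 0 ≤ AdaptedWasserstein.moment p μ :=
    integral_nonneg fun x => Real.rpow_nonneg (AdaptedWasserstein.pathNorm_nonneg x) p
  have hC0 : 0 < C := hC ▸ AdaptedWasserstein.meanConst_pos (by positivity) (by positivity) hσ hp hM0
  have hcle := AdaptedWasserstein.le_deviationConst
    (c₁ := 3 * (1 + (AdaptedWasserstein.gaussianMoment d T 1).toReal)) (by positivity) hσ hσ1 hK hk
  rw [← hc, hkR] at hcle
  have hm1 : 0 ≤ (AdaptedWasserstein.gaussianMoment d T 1).toReal := ENNReal.toReal_nonneg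
  have hc0 : 0 < c := lt_of_lt_of_le (by positivity) hcle
  refine ⟨hC0, hc0, fun Ω _ P _ X hX hlaw hind N hN => ?_⟩
  have hp0 : 0 ≤ p := by
    have : (0 : ℝ) ≤ d * T := by positivity
    linarith
  have hint : Integrable (fun x => AdaptedWasserstein.pathNorm x ^ p) μ := by
    refine Integrable.of_bound (AdaptedWasserstein.measurable_pathNorm.pow_const
      p).aestronglyMeasurable ((R : ℝ) ^ p) ?_
    have hμK' : ∀ᵐ a ∂μ, a ∈ K := by rwa [ae_iff]
    filter_upwards [hμK'] with a ha
    have := AdaptedWasserstein.pathNorm_nonneg a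
    rw [Real.norm_of_nonneg (by positivity)]
    exact Real.rpow_le_rpow this (hR a ha) hp0
  have hmean := AdaptedWasserstein.lintegral_empiricalDist_le hσ hp μ hint hN
    (X := fun i : Fin N => X i) (fun i => hX i) (fun i => hlaw i) (hind.precomp Fin.val_injective)
  rw [← hC] at hmean
  simp only [mul_assoc]
  refine AdaptedWasserstein.mean_and_deviation_bound hσ hσ1 (hA σ hσ hσ1) hK hR hne hμK
    (by positivity) (by positivity) (by simp) ?_ hX hlaw hind hN hmean
  have hw : (AdaptedWasserstein.weightBound d T R : ℝ) =
      (AdaptedWasserstein.gaussianMoment d T 1).toReal + R + 1 / 2 := by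
    simp [AdaptedWasserstein.weightBound, ENNReal.coe_toNNReal_eq_toReal]
  -- With `m₁` the first Gaussian moment, `(1 + m₁)(R + 3/2) ≥ m₁ + R + 1/2`.
  have h3 : 3 * (AdaptedWasserstein.weightBound d T R : ℝ) ≤ c := by
    rw [hw]
    refine le_trans ?_ hcle
    nlinarith [R.2, mul_nonneg hm1 R.2]
  have hw0 : 0 ≤ (AdaptedWasserstein.weightBound d T R : ℝ) := NNReal.coe_nonneg _
  nlinarith
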